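/- All graphs are finite, undirected, without loops or multiple edges. The edge polytope $\mathcal{P}(G)$ of a graph $G$ on the vertex set $\{1,\dots,n\}$ is the convex hull in $\mathbb{R}^n$ of all vectors $e_i+e_j$ such that $i$ is adjacent to $j$, where $e_i$ denotes the $i$th unit vector. A polytope $P$ is $k$-neighborly if every set of at most $k$ of its vertices is the vertex set of a face of $P$ (the empty set and $P$ itself count as faces). (i) Let $k \ge 2$ be a fixed integer. Then every $k$-neighborly edge polytope of an $n$-vertex graph has at most $$\tfrac12 n^{1+1/k}+\Bigl(\tfrac{k-1}{2k}+o(1)\Bigr)n$$ vertices, where the $o(1)$ term depends only on $k$ and $n$, and tends to $0$ as $n\to\infty$ with $k$ fixed. (ii) For each $k\in\{2,3,5\}$ there are infinitely many positive integers $n$ for which there is an $n$-vertex graph $G_n$ without isolated vertices whose edge polytope is $k$-neighborly and has at least $$\tfrac12 n^{1+1/k}+\tfrac{k-1}{2k}\,n-n^{1-1/k}$$ vertices. -/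

import Mathlib

open Filter Topology

/-- The edge polytope of a graph `G` on the vertex set `V`: the convex hull in `ℝ^V` of all
vectors `e_i + e_j` such that `i` is adjacent to `j`. -/
def edgePolytope {V : Type*} [DecidableEq V] (G : SimpleGraph V) : Set (V → ℝ) :=
  convexHull ℝ {x | ∃ i j, G.Adj i j ∧ x = Pi.single i 1 + Pi.single j 1}

/-- The vertex set of a polytope: its set of extreme points. -/
def polytopeVertices {V : Type*} (P : Set (V → ℝ)) : Set (V → ℝ) :=
  Set.extremePoints ℝ P

/-- A polytope `P` is `k`-neighborly if every set `S` of at most `k` of its vertices defines a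
face, i.e. `conv S` is a face of `P`. Faces are the subsets of `P` on which some linear functional
attains its maximum over `P`, and the empty face (this is `IsExposed`). -/
def IsNeighborly {V : Type*} (k : ℕ) (P : Set (V → ℝ)) : Prop :=
  ∀ S : Set (V → ℝ), S ⊆ polytopeVertices P → S.encard ≤ k → IsExposed ℝ P (convexHull ℝ S)

/-!
The dependencies between edge vectors control the faces of an edge polytope: it is `k`-neighborly
exactly when every nontrivial linear dependency between the vectors `e_i + e_j` has more than `k`
positive coefficients (`IsNeighborly.eq_zero_of_dependency`, `isNeighborly_of_forall_dependency`).
The alternating sum of the edge vectors along a closed walk of even length is such a dependency, so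
neighborliness is almost the statement that there is no closed non-backtracking walk of even
length at most `2k` (`NoShortEvenWalk`), that is, that the bipartite double cover of the graph has
girth at least `2k + 2`. This condition is sufficient (`NoShortEvenWalk.isNeighborly`). It fails to
be necessary only because of odd cycles of length at most `k`: going twice around one of them gives
the zero dependency.

*Upper bound.* In a graph of large minimum degree with a `k`-neighborly edge polytope, odd closed
walks of length less than `k` that traverse different edges modulo two have base points with
disjoint neighborhoods, so that deleting `o(n)` edges destroys them all
(`IsBalanced.exists_noShortOddWalk`); odd cycles of length exactly `k` cause only a small loss in
the count below. After that, the non-backtracking walks of length `k` from a vertex have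
essentially distinct end points. Their total number is at least `n d (d - 1) ^ (k - 1)`, where `d` is
the average degree: this is the entropy argument of Alon, Hoory and Linial, in the form of an
induction on the sum of the logarithms of the numbers of walks (`sum_log_card_nbEnds_ge`). Hence
`d (d - 1) ^ (k - 1) ≤ n + (k - 2) d` (`AlmostNoShortEvenWalk.moore_bound`), and solving for `d` gives
`d ≤ n ^ (1 / k) + (k - 1) / k + o(1)`.

*Lower bound.* The polarity graph of a self-polar generalized `(k + 1)`-gon of order `q` has no short
even closed walks, since its double cover is the incidence graph of the polygon up to loops. The
polygons are the projective plane, the symplectic quadrangle for `q = 2 ^ (2e + 1)`, and the split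
Cayley hexagon for `q = 3 ^ (2e + 1)`; the polarities come from an endomorphism of the field whose
square is the Frobenius map. It suffices to keep the `q ^ k` vertices in general position and the
`q ^ (k - 1)` vertices next to them (`fiberGraph`), and then Bernoulli's inequality yields the bound
for every `q` (`lower_bound_arith`). The girth is checked with algebraic models of the polygons. In
the quadrangle, two points with a common neighbor are orthogonal for the symplectic form, while the
ends of a path through two different lines are not. In the hexagon, points are split octonions,
collinear points have product zero, the product of the ends of a path through two different lines is
a nonzero multiple of its middle point, and the alternative law excludes pentagons.
-/

/-! ### Edge vectors and faces of the edge polytope -/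

/-- The vector `e_i + e_j` attached to the unordered pair `{i, j}`. -/
noncomputable def edgeVec {V : Type*} [DecidableEq V] : Sym2 V → V → ℝ :=
  Sym2.lift ⟨fun i j => Pi.single i 1 + Pi.single j 1, fun _ _ => add_comm _ _⟩

/-- The points of a convex hull at which a linear functional reaches its maximum over the
generators are the convex combinations of the generators where it does. -/
theorem mem_convexHull_of_maximal {E : Type*} [AddCommGroup E] [Module ℝ E] (Q : Set E)
    (l : E →ₗ[ℝ] ℝ) (M : ℝ) (hM : ∀ q ∈ Q, l q ≤ M) {y : E} (hy : y ∈ convexHull ℝ Q) :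
    l y < M ∨ (l y = M ∧ y ∈ convexHull ℝ {q ∈ Q | l q = M}) := by
  let C : Set E := {y | l y < M ∨ (l y = M ∧ y ∈ convexHull ℝ {q ∈ Q | l q = M})}
  have hC : Convex ℝ C := by
    rw [convex_iff_forall_pos]
    intro x hx y hy a b ha hb hab
    have hl : l (a • x + b • y) = a * l x + b * l y := by simp
    have hMM : a * M + b * M = M := by rw [← add_mul, hab, one_mul]
    rcases hx with hx | ⟨hx, hx'⟩
    · left
      have : l y ≤ M := by rcases hy with hy | hy; exacts [hy.le, hy.1.le]
      have h1 := mul_lt_mul_of_pos_left hx ha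
      have h2 := mul_le_mul_of_nonneg_left this hb.le
      rw [hl]
      linarith
    · rcases hy with hy | ⟨hy, hy'⟩
      · left
        have h1 := mul_lt_mul_of_pos_left hy hb
        rw [hl, hx]
        linarith
      · right
        refine ⟨by rw [hl, hx, hy, ← add_mul, hab, one_mul], ?_⟩
        exact convex_convexHull ℝ _ hx' hy' ha.le hb.le hab
  refine convexHull_min (t := C) ?_ hC hy
  intro q hq
  rcases (hM q hq).lt_or_eq with h | h
  · exact Or.inl h
  · exact Or.inr ⟨h, subset_convexHull ℝ _ ⟨hq, h⟩⟩

theorem le_of_mem_convexHull {E : Type*} [AddCommGroup E] [Module ℝ E] (Q : Set E)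
    (l : E →ₗ[ℝ] ℝ) (M : ℝ) (hM : ∀ q ∈ Q, l q ≤ M) {y : E} (hy : y ∈ convexHull ℝ Q) :
    l y ≤ M := by
  rcases mem_convexHull_of_maximal Q l M hM hy with h | h
  exacts [h.le, h.1.le]

/-- The generators at which a linear functional reaches its maximum span an exposed face. -/
theorem isExposed_convexHull_of_maximal {V : Type*} [Fintype V] (Q S : Set (V → ℝ))
    (l : (V → ℝ) →L[ℝ] ℝ) (M : ℝ) (hM : ∀ q ∈ Q, l q ≤ M) (hS : {q ∈ Q | l q = M} = S)
    (hne : S.Nonempty) : IsExposed ℝ (convexHull ℝ Q) (convexHull ℝ S) := by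
  intro _
  refine ⟨l, ?_⟩
  have hSM : ∀ y ∈ convexHull ℝ S, l y = M := by
    intro y hy
    have h1 : convexHull ℝ S ⊆ {y | l y = M} := by
      refine convexHull_min (fun q hq => ?_) ?_
      · rw [← hS] at hq; exact hq.2
      · exact (convex_singleton M).linear_preimage l.toLinearMap
    exact h1 hy
  ext y
  constructor
  · intro hy
    refine ⟨convexHull_mono (by rw [← hS]; exact Set.sep_subset _ _) hy, fun z hz => ?_⟩
    rw [hSM y hy]
    exact le_of_mem_convexHull Q l.toLinearMap M hM hz
  · rintro ⟨hy, hmax⟩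
    obtain ⟨q, hq⟩ := hne
    rw [← hS] at hq ⊢
    have h1 := hmax q (subset_convexHull ℝ _ hq.1)
    rw [hq.2] at h1
    rcases mem_convexHull_of_maximal Q l.toLinearMap M hM hy with h | h
    · exact absurd h (not_lt.mpr h1)
    · exact h.2

section
variable {V : Type*} [DecidableEq V]

theorem edgeVec_mk (i j : V) :
    edgeVec s(i, j) = (Pi.single i 1 + Pi.single j 1 : V → ℝ) := rfl

theorem edgePolytope_eq (G : SimpleGraph V) :
    edgePolytope G = convexHull ℝ (edgeVec '' G.edgeSet) := by
  unfold edgePolytope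
  congr 1
  ext x
  constructor
  · rintro ⟨i, j, h, rfl⟩
    exact ⟨s(i, j), h, rfl⟩
  · rintro ⟨e, he, rfl⟩
    induction e with | _ i j
    exact ⟨i, j, he, rfl⟩

theorem edgeVec_apply_self_add (i j : V) (hij : i ≠ j) :
    edgeVec s(i, j) i + edgeVec s(i, j) j = 2 := by
  simp [edgeVec_mk, hij, hij.symm]
  norm_num

theorem edgeVec_apply_add_lt (i j : V) (hij : i ≠ j) (e : Sym2 V) (hd : ¬ e.IsDiag)
    (he : e ≠ s(i, j)) : edgeVec e i + edgeVec e j < 2 := by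
  induction e with | _ a b
  simp only [Sym2.mk_isDiag_iff] at hd
  simp only [edgeVec_mk, Pi.add_apply, Pi.single_apply]
  have h1 : ¬ (i = a ∧ j = b) := by rintro ⟨rfl, rfl⟩; exact he rfl
  have h2 : ¬ (i = b ∧ j = a) := by rintro ⟨rfl, rfl⟩; exact he Sym2.eq_swap
  split_ifs <;> first | (norm_num; done) | grind

theorem edgeVec_injOn : Set.InjOn (edgeVec (V := V)) {e | ¬ e.IsDiag} := by
  intro e he f hf h
  by_contra hne
  induction e with | _ i j
  have hij : i ≠ j := by simpa using he
  have := edgeVec_apply_add_lt i j hij f hf (Ne.symm hne)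
  rw [← h, edgeVec_apply_self_add i j hij] at this
  exact lt_irrefl _ this

theorem polytopeVertices_edgePolytope [Fintype V] (G : SimpleGraph V) :
    polytopeVertices (edgePolytope G) = edgeVec '' G.edgeSet := by
  rw [edgePolytope_eq]
  apply Set.Subset.antisymm
  · exact extremePoints_convexHull_subset
  · rintro _ ⟨e, he, rfl⟩
    induction e with | _ i j
    have hij : i ≠ j := G.ne_of_adj he
    let l : (V → ℝ) →L[ℝ] ℝ :=
      ContinuousLinearMap.proj (R := ℝ) (φ := fun _ => ℝ) i + ContinuousLinearMap.proj j
    have hl : ∀ x, l x = x i + x j := fun x => rfl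
    have key : IsExposed ℝ (convexHull ℝ (edgeVec '' G.edgeSet))
        (convexHull ℝ {edgeVec s(i, j)}) := by
      refine isExposed_convexHull_of_maximal _ _ l 2 ?_ ?_ (Set.singleton_nonempty _)
      · rintro _ ⟨f, hf, rfl⟩
        rw [hl]
        by_cases h : f = s(i, j)
        · rw [h, edgeVec_apply_self_add i j hij]
        · exact (edgeVec_apply_add_lt i j hij f (G.not_isDiag_of_mem_edgeSet hf) h).le
      · ext y
        constructor
        · rintro ⟨⟨f, hf, rfl⟩, hy⟩
          by_cases h : f = s(i, j)
          · rw [h]; rfl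
          · rw [hl] at hy
            exact absurd hy (edgeVec_apply_add_lt i j hij f (G.not_isDiag_of_mem_edgeSet hf) h).ne
        · rintro rfl
          exact ⟨⟨_, he, rfl⟩, edgeVec_apply_self_add i j hij⟩
    rw [convexHull_singleton] at key
    exact isExtreme_singleton.1 key.isExtreme

theorem ncard_polytopeVertices [Fintype V] (G : SimpleGraph V) :
    (polytopeVertices (edgePolytope G)).ncard = G.edgeSet.ncard := by
  rw [polytopeVertices_edgePolytope]
  exact (edgeVec_injOn.mono fun e he => G.not_isDiag_of_mem_edgeSet he).ncard_image

theorem sum_edgeVec [Fintype V] (e : Sym2 V) : ∑ v, edgeVec e v = 2 := by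
  induction e with | _ i j
  simp only [edgeVec_mk, Pi.add_apply, Finset.sum_add_distrib, Finset.sum_pi_single']
  norm_num

/-- In a `k`-neighborly edge polytope, a linear dependency between edge vectors that has at most
`k` positive coefficients is trivial. -/
theorem IsNeighborly.eq_zero_of_dependency [Fintype V] {G : SimpleGraph V} {k : ℕ}
    (h : IsNeighborly k (edgePolytope G)) (c : Sym2 V → ℝ) (hc : ∀ e, c e ≠ 0 → e ∈ G.edgeSet)
    (hsum : ∑ e, c e • edgeVec e = 0) (hcard : {e | 0 < c e}.encard ≤ k) : c = 0 := by
  have hsum0 : ∑ e, c e = 0 := by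
    have h1 : ∑ v, (∑ e, c e • edgeVec e) v = 0 := by rw [hsum]; simp
    simp only [Finset.sum_apply, Pi.smul_apply, smul_eq_mul] at h1
    rw [Finset.sum_comm] at h1
    simp only [← Finset.mul_sum, sum_edgeVec] at h1
    rw [← Finset.sum_mul] at h1
    linarith
  have hpos : ∀ e, 0 ≤ c e → c e = 0 ∨ 0 < c e := fun e he => he.eq_or_lt.imp_left Eq.symm
  by_contra hne
  have hex : ∃ e, 0 < c e := by
    by_contra hno
    push Not at hno
    apply hne
    funext e
    exact (Finset.sum_eq_zero_iff_of_nonpos (fun e _ => hno e)).1 hsum0 e (Finset.mem_univ e)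
  obtain ⟨e₀, he₀⟩ := hex
  let S : Set (V → ℝ) := edgeVec '' {e | 0 < c e}
  have hSv : S ⊆ polytopeVertices (edgePolytope G) := by
    rw [polytopeVertices_edgePolytope]
    exact Set.image_mono fun e he => hc e (ne_of_gt he)
  have hexp := h S hSv ((Set.encard_image_le _ _).trans hcard)
  have hS0 : edgeVec e₀ ∈ convexHull ℝ S := subset_convexHull ℝ _ ⟨e₀, he₀, rfl⟩
  obtain ⟨l, hl⟩ := hexp ⟨_, hS0⟩
  have hmem : ∀ e ∈ G.edgeSet, edgeVec e ∈ edgePolytope G := fun e he => by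
    rw [edgePolytope_eq]; exact subset_convexHull ℝ _ ⟨e, he, rfl⟩
  have hle : ∀ e ∈ G.edgeSet, l (edgeVec e) ≤ l (edgeVec e₀) := fun e he => by
    rw [hl] at hS0; exact hS0.2 _ (hmem e he)
  have hlt : ∀ e, c e < 0 → l (edgeVec e) < l (edgeVec e₀) := by
    intro e he
    have heG := hc e he.ne
    refine (hle e heG).lt_of_ne fun heq => ?_
    have h1 : edgeVec e ∈ convexHull ℝ S := by
      rw [hl]
      refine ⟨hmem e heG, fun y hy => ?_⟩
      rw [hl] at hS0
      rw [heq]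
      exact hS0.2 y hy
    -- a vertex of the polytope that lies in the convex hull of some vertices is one of them
    have h2 : edgeVec e ∈ Set.extremePoints ℝ (convexHull ℝ S) := by
      have h3 : edgeVec e ∈ polytopeVertices (edgePolytope G) := by
        rw [polytopeVertices_edgePolytope]; exact ⟨e, heG, rfl⟩
      refine inter_extremePoints_subset_extremePoints_of_subset ?_ ⟨h1, h3⟩
      rw [edgePolytope_eq]
      exact convexHull_mono (Set.image_mono fun e he => hc e (ne_of_gt he))
    obtain ⟨f, hf, hfe⟩ := extremePoints_convexHull_subset h2
    have : f = e := edgeVec_injOn (G.not_isDiag_of_mem_edgeSet (hc f (ne_of_gt hf)))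
      (G.not_isDiag_of_mem_edgeSet heG) hfe
    rw [this] at hf
    exact lt_asymm hf he
  have hz : ∑ e, c e * (l (edgeVec e) - l (edgeVec e₀)) = 0 := by
    simp only [mul_sub, Finset.sum_sub_distrib, ← Finset.sum_mul, hsum0, zero_mul, sub_zero]
    have := congrArg l hsum
    simpa using this
  have hnn : ∀ e ∈ Finset.univ, 0 ≤ c e * (l (edgeVec e) - l (edgeVec e₀)) := by
    intro e _
    rcases lt_trichotomy (c e) 0 with h1 | h1 | h1
    · exact (mul_pos_of_neg_of_neg h1 (sub_neg.2 (hlt e h1))).le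
    · simp [h1]
    · have h2 : edgeVec e ∈ convexHull ℝ S := subset_convexHull ℝ _ ⟨e, h1, rfl⟩
      rw [hl] at h2
      exact mul_nonneg h1.le (sub_nonneg.2 (h2.2 _ (hmem e₀ (hc e₀ he₀.ne'))))
  have hall := (Finset.sum_eq_zero_iff_of_nonneg hnn).1 hz
  have hcn : ∀ e, 0 ≤ c e := by
    intro e
    by_contra hlt0
    push Not at hlt0
    exact (mul_pos_of_neg_of_neg hlt0 (sub_neg.2 (hlt e hlt0))).ne' (hall e (Finset.mem_univ e))
  exact he₀.ne' ((Finset.sum_eq_zero_iff_of_nonneg fun e _ => hcn e).1 hsum0 e₀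
    (Finset.mem_univ e₀))

/-- Conversely, the absence of such dependencies makes the edge polytope neighborly: a set of edge
vectors spans a face when its linear span misses the convex hull of the other edge vectors, by
separation. -/
theorem isNeighborly_of_forall_dependency [Fintype V] {G : SimpleGraph V} {k : ℕ}
    (h : ∀ c : Sym2 V → ℝ, (∀ e, c e ≠ 0 → e ∈ G.edgeSet) → ∑ e, c e • edgeVec e = 0 →
      {e | 0 < c e}.encard ≤ k → c = 0) : IsNeighborly k (edgePolytope G) := by
  intro S hS hcard
  rcases S.eq_empty_or_nonempty with rfl | hne
  · rw [convexHull_empty]; exact isExposed_empty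
  rw [polytopeVertices_edgePolytope] at hS
  rw [edgePolytope_eq]
  let A : Set (Sym2 V) := {e | e ∈ G.edgeSet ∧ edgeVec e ∈ S}
  let L : (Sym2 V → ℝ) →ₗ[ℝ] (V → ℝ) := Fintype.linearCombination ℝ edgeVec
  have hL : ∀ c, L c = ∑ e, c e • edgeVec e := fun c => Fintype.linearCombination_apply ℝ _ c
  have hLs : ∀ e, L (Pi.single e 1) = edgeVec e := fun e => by
    rw [Fintype.linearCombination_apply_single, one_smul]
  have hLc : Continuous L := L.continuous_of_finiteDimensional
  let K₁ : Set (Sym2 V → ℝ) := stdSimplex ℝ (Sym2 V) ∩ {c | ∀ e, e ∉ G.edgeSet \ A → c e = 0}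
  let K₂ : Submodule ℝ (Sym2 V → ℝ) :=
    { carrier := {c | ∀ e, e ∉ A → c e = 0}
      add_mem' := fun ha hb e he => by simp [ha e he, hb e he]
      zero_mem' := fun e _ => rfl
      smul_mem' := fun r c hc e he => by simp [hc e he] }
  have hK₁c : Convex ℝ K₁ := by
    refine (convex_stdSimplex ℝ _).inter ?_
    intro x hx y hy a b _ _ _ e he
    simp [hx e he, hy e he]
  have hK₁k : IsCompact K₁ := by
    refine (isCompact_stdSimplex ℝ (Sym2 V)).inter_right ?_
    have : {c : Sym2 V → ℝ | ∀ e, e ∉ G.edgeSet \ A → c e = 0}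
        = ⋂ e, ⋂ (_ : e ∉ G.edgeSet \ A), {c | c e = 0} := by
      ext c; simp
    rw [this]
    exact isClosed_iInter fun e => isClosed_iInter fun _ =>
      isClosed_eq (continuous_apply e) continuous_const
  have hdisj : Disjoint (L '' K₁) (K₂.map L : Set (V → ℝ)) := by
    rw [Set.disjoint_left]
    rintro _ ⟨x, hx, rfl⟩ ⟨y, hy, hxy⟩
    have hx0 := hx.1.1
    have hxT : ∀ e, x e ≠ 0 → e ∈ G.edgeSet ∧ e ∉ A := fun e he => by
      by_contra hcon
      exact he (hx.2 e hcon)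
    have hyA : ∀ e, y e ≠ 0 → e ∈ A := fun e he => by
      by_contra hcon
      exact he (hy e hcon)
    have hposA : ∀ e, 0 < y e - x e → e ∈ A := fun e he => by
      apply hyA
      have := hx0 e
      linarith [he]
    have h0 := h (fun e => y e - x e) ?_ ?_ ?_
    · obtain ⟨e, he⟩ : ∃ e, x e ≠ 0 := by
        by_contra hcon
        push Not at hcon
        have := hx.1.2
        simp [hcon] at this
      have h1 := congrFun h0 e
      have h2 : y e = 0 := hy e (hxT e he).2
      simp only [h2, Pi.zero_apply, zero_sub, neg_eq_zero] at h1
      exact he h1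
    · intro e he
      by_cases hxe : x e = 0
      · exact (hyA e (by simpa [hxe] using he)).1
      · exact (hxT e hxe).1
    · simp only [sub_smul, Finset.sum_sub_distrib]
      rw [← hL, ← hL, hxy, sub_self]
    · refine le_trans ?_ hcard
      refine Set.encard_le_encard_of_injOn (f := edgeVec) (fun e he => (hposA e he).2) ?_
      exact edgeVec_injOn.mono fun e he => G.not_isDiag_of_mem_edgeSet (hposA e he).1
  obtain ⟨f, u, v, hfu, huv, hfv⟩ := geometric_hahn_banach_compact_closed (hK₁c.linear_image L)
    (hK₁k.image hLc) (K₂.map L).convex (Submodule.closed_of_finiteDimensional _) hdisj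
  have hv0 : v < 0 := by simpa using hfv 0 (Submodule.zero_mem _)
  have hf0 : ∀ b ∈ K₂.map L, f b = 0 := by
    intro b hb
    by_contra hb0
    have := hfv (((v - 1) / f b) • b) (Submodule.smul_mem _ _ hb)
    rw [map_smul, smul_eq_mul, div_mul_cancel₀ _ hb0] at this
    linarith
  refine isExposed_convexHull_of_maximal _ S f 0 ?_ ?_ hne
  all_goals
    have hAS : ∀ e ∈ A, f (edgeVec e) = 0 := fun e he => by
      refine hf0 _ ⟨Pi.single e 1, fun e' he' => ?_, hLs e⟩
      rw [Pi.single_apply, if_neg]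
      rintro rfl
      exact he' he
    have hTS : ∀ e ∈ G.edgeSet, e ∉ A → f (edgeVec e) < 0 := fun e heG he => by
      refine (hfu _ ⟨Pi.single e 1, ⟨single_mem_stdSimplex ℝ e, fun e' he' => ?_⟩, hLs e⟩).trans
        (huv.trans hv0)
      rw [Pi.single_apply, if_neg]
      rintro rfl
      exact he' ⟨heG, he⟩
  · rintro _ ⟨e, he, rfl⟩
    by_cases heA : e ∈ A
    · exact (hAS e heA).le
    · exact (hTS e he heA).le
  · ext y
    constructor
    · rintro ⟨⟨e, he, rfl⟩, hy⟩
      by_contra hcon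
      exact (hTS e he fun h => hcon h.2).ne hy
    · intro hy
      obtain ⟨e, he, rfl⟩ := hS hy
      exact ⟨⟨e, he, rfl⟩, hAS e ⟨he, hy⟩⟩

end

/-! ### Non-backtracking walks -/

section
variable {V : Type*}

/-- `w 0, w 1, …, w r` is a walk of `G` that never returns along the edge just used. Only the
values of `w` up to `r` matter; a closed walk may backtrack at its base point. -/
structure IsNBWalk (G : SimpleGraph V) (r : ℕ) (w : ℕ → V) : Prop where
  adj : ∀ i < r, G.Adj (w i) (w (i + 1))
  ne : ∀ i, i + 2 ≤ r → w i ≠ w (i + 2)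

/-- No closed non-backtracking walk of even length between `2` and `2k`. Equivalently, the
bipartite double cover of `G` has girth at least `2k + 2`. -/
def NoShortEvenWalk (G : SimpleGraph V) (k : ℕ) : Prop :=
  ∀ m, 1 ≤ m → m ≤ k → ∀ w, IsNBWalk G (2 * m) w → w 0 ≠ w (2 * m)

theorem IsNBWalk.shift {G : SimpleGraph V} {r : ℕ} {w : ℕ → V} (h : IsNBWalk G r w) (s t : ℕ)
    (hst : s + t ≤ r) : IsNBWalk G t (fun i => w (s + i)) :=
  ⟨fun i hi => h.adj (s + i) (by omega), fun i hi => h.ne (s + i) (by omega)⟩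

/-- Going twice around a closed non-backtracking walk of odd length gives an even one, once the
tail that is traversed back and forth at the base point has been removed. -/
theorem NoShortEvenWalk.odd {G : SimpleGraph V} {k : ℕ} (h : NoShortEvenWalk G k) (b : ℕ) :
    2 * b + 1 ≤ k → ∀ w, IsNBWalk G (2 * b + 1) w → w 0 ≠ w (2 * b + 1) := by
  induction b with
  | zero =>
    intro _ w hw h0
    have := hw.adj 0 (by omega)
    rw [← h0] at this
    exact G.loopless.irrefl _ this
  | succ b ih =>
    intro hb w hw h0
    by_cases h1 : w 1 = w (2 * (b + 1))
    · refine ih (by omega) _ (hw.shift 1 (2 * b + 1) (by omega)) ?_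
      simp only [add_zero]
      rw [h1]; congr 1; omega
    · set a := 2 * (b + 1) + 1 with ha
      refine h a (by omega) (by omega) (fun i => if i ≤ a then w i else w (i - a)) ⟨?_, ?_⟩ ?_
      · intro i hi
        by_cases h2 : i < a
        · simpa [h2.le, Nat.succ_le_of_lt h2] using hw.adj i h2
        · have h3 := hw.adj (i - a) (by omega)
          by_cases h4 : i = a
          · subst h4
            simpa [h0] using h3
          · simp only [show ¬ i ≤ a by omega, show ¬ i + 1 ≤ a by omega, if_false]
            rwa [show i - a + 1 = i + 1 - a by omega] at h3
      · intro i hi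
        by_cases h2 : i + 2 ≤ a
        · simpa [h2, show i ≤ a by omega] using hw.ne i h2
        · by_cases h4 : i + 1 = a
          · simp only [show i ≤ a by omega, show ¬ i + 2 ≤ a by omega, if_false, if_true]
            rw [show i + 2 - a = 1 by omega, show i = 2 * (b + 1) by omega]
            exact fun h => h1 h.symm
          · have h3 := hw.ne (i - a) (by omega)
            by_cases h5 : i = a
            · subst h5
              simpa [← h0] using h3
            · simp only [show ¬ i ≤ a by omega, show ¬ i + 2 ≤ a by omega, if_false]
              rwa [show i - a + 2 = i + 2 - a by omega] at h3
      · simp only [Nat.zero_le, if_true, show ¬ 2 * a ≤ a by omega, if_false]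
        rw [show 2 * a - a = a by omega]
        exact h0

/-! ### Alternating walks and neighborliness -/

/-- An infinite walk whose edges lie alternately in `N` and in `P`, starting with `N`. -/
structure IsAlternating (P N : Set (Sym2 V)) (c : ℕ → V) : Prop where
  memN : ∀ i, Even i → s(c i, c (i + 1)) ∈ N
  memP : ∀ i, Odd i → s(c i, c (i + 1)) ∈ P

section alternating
variable {P N : Set (Sym2 V)}

theorem IsAlternating.isNBWalk {G : SimpleGraph V} {c : ℕ → V} (h : IsAlternating P N c)
    (hP : P ⊆ G.edgeSet) (hN : N ⊆ G.edgeSet) (hPN : Disjoint P N) (r : ℕ) :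
    IsNBWalk G r c := by
  refine ⟨fun i _ => ?_, fun i _ heq => ?_⟩
  · rcases i.even_or_odd with hi | hi
    · exact hN (h.memN i hi)
    · exact hP (h.memP i hi)
  · rcases i.even_or_odd with hi | hi
    · have h1 := h.memN i hi
      have h2 := h.memP (i + 1) hi.add_one
      rw [← heq, Sym2.eq_swap] at h2
      exact Set.disjoint_left.1 hPN h2 h1
    · have h1 := h.memP i hi
      have h2 := h.memN (i + 1) hi.add_one
      rw [← heq, Sym2.eq_swap] at h2
      exact Set.disjoint_left.1 hPN h1 h2

theorem IsAlternating.shift {c : ℕ → V} (h : IsAlternating P N c) (s : ℕ) (hs : Even s) :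
    IsAlternating P N (fun i => c (s + i)) :=
  ⟨fun i hi => h.memN (s + i) (hs.add hi), fun i hi => h.memP (s + i) (hs.add_odd hi)⟩

/-- Reversing an initial closed segment of odd length of an alternating walk. -/
theorem IsAlternating.reverse {c : ℕ → V} (h : IsAlternating P N c) {a : ℕ} (ha : Odd a)
    (h0 : c 0 = c a) : IsAlternating P N (fun i => if i ≤ a then c (a - i) else c i) := by
  have key : ∀ i, i < a → (s((if i ≤ a then c (a - i) else c i),
      if i + 1 ≤ a then c (a - (i + 1)) else c (i + 1)) : Sym2 V)
        = s(c (a - (i + 1)), c (a - (i + 1) + 1)) := by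
    intro i hi
    rw [if_pos hi.le, if_pos (Nat.succ_le_of_lt hi), Sym2.eq_swap,
      show a - (i + 1) + 1 = a - i by omega]
  have key' : ∀ i, a ≤ i → (s((if i ≤ a then c (a - i) else c i),
      if i + 1 ≤ a then c (a - (i + 1)) else c (i + 1)) : Sym2 V) = s(c i, c (i + 1)) := by
    intro i hi
    rw [if_neg (show ¬ i + 1 ≤ a by omega)]
    split_ifs with h1
    · rw [show i = a by omega, Nat.sub_self, h0]
    · rfl
  constructor
  · intro i hi
    rcases lt_or_ge i a with h1 | h1
    · rw [key i h1]
      refine h.memN _ ?_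
      obtain ⟨x, rfl⟩ := ha
      obtain ⟨y, rfl⟩ := hi
      exact ⟨x - y, by omega⟩
    · rw [key' i h1]; exact h.memN i hi
  · intro i hi
    rcases lt_or_ge i a with h1 | h1
    · rw [key i h1]
      refine h.memP _ ?_
      obtain ⟨x, rfl⟩ := ha
      obtain ⟨y, rfl⟩ := hi
      exact ⟨x - y - 1, by omega⟩
    · rw [key' i h1]; exact h.memP i hi

/-- Following edges of `N` and of `P` in turn never gets stuck when both families touch the same
vertices. -/
theorem exists_isAlternating (hPN : ∀ x y, s(x, y) ∈ P → ∃ z, s(x, z) ∈ N)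
    (hNP : ∀ x y, s(x, y) ∈ N → ∃ z, s(x, z) ∈ P) (hne : N.Nonempty) :
    ∃ c, IsAlternating P N c := by
  classical
  obtain ⟨e, he⟩ := hne
  induction e with | _ x₀ y₀
  have hf : ∀ x, ∃ z, (∃ y, s(x, y) ∈ N) → s(x, z) ∈ N := fun x => by
    by_cases h : ∃ y, s(x, y) ∈ N
    · exact ⟨h.choose, fun _ => h.choose_spec⟩
    · exact ⟨x, fun h' => absurd h' h⟩
  have hg : ∀ x, ∃ z, (∃ y, s(x, y) ∈ N) → s(x, z) ∈ P := fun x => by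
    by_cases h : ∃ y, s(x, y) ∈ N
    · obtain ⟨y, hy⟩ := h
      exact (hNP x y hy).imp fun z hz _ => hz
    · exact ⟨x, fun h' => absurd h' h⟩
  choose f hf using hf
  choose g hg using hg
  let c : ℕ → V := fun n => Nat.rec x₀ (fun n x => if Even n then f x else g x) n
  have hc : ∀ n, c (n + 1) = if Even n then f (c n) else g (c n) := fun n => rfl
  have hinv : ∀ n, ∃ y, s(c n, y) ∈ N := by
    intro n
    induction n with
    | zero => exact ⟨y₀, he⟩
    | succ n ih =>
      rw [hc]
      split_ifs
      · exact ⟨c n, by rw [Sym2.eq_swap]; exact hf _ ih⟩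
      · exact hPN _ (c n) (by rw [Sym2.eq_swap]; exact hg _ ih)
  refine ⟨c, fun i hi => ?_, fun i hi => ?_⟩
  · rw [hc, if_pos hi]; exact hf _ (hinv i)
  · rw [hc, if_neg (Nat.not_even_iff_odd.2 hi)]; exact hg _ (hinv i)

/-- The combinatorial core of the neighborliness criterion. An alternating walk with at most `k`
distinct `P`-edges must traverse one of them in both directions, which closes an odd subwalk. If
that subwalk is as short as possible, then the first `k + 1` `P`-edges from its start on are
distinct. -/
theorem NoShortEvenWalk.not_balanced_pair {G : SimpleGraph V} {k : ℕ} (h : NoShortEvenWalk G k)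
    (hP : P ⊆ G.edgeSet) (hN : N ⊆ G.edgeSet) (hdis : Disjoint P N)
    (hPN : ∀ x y, s(x, y) ∈ P → ∃ z, s(x, z) ∈ N) (hNP : ∀ x y, s(x, y) ∈ N → ∃ z, s(x, z) ∈ P)
    (hne : N.Nonempty) (hcard : P.encard ≤ k) : False := by
  classical
  have hPfin : P.Finite := Set.finite_of_encard_le_coe hcard
  have hPc : hPfin.toFinset.card ≤ k := by
    rw [hPfin.encard_eq_coe_toFinset_card] at hcard
    exact_mod_cast hcard
  -- two segments of even length at most `2k` cannot close up
  have heven : ∀ c, IsAlternating P N c → ∀ i j, i < j → Even (j - i) → j - i ≤ 2 * k →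
      c i ≠ c j := by
    intro c hc i j hij hev hle heq
    obtain ⟨m, hm⟩ := hev
    refine h m (by omega) (by omega) (fun t => c (i + t))
      ((hc.isNBWalk hP hN hdis (i + 2 * m)).shift i (2 * m) le_rfl) ?_
    simp only [add_zero]
    rw [heq]; congr 1; omega
  have hodd : ∀ c, IsAlternating P N c → ∀ i j, i < j → Odd (j - i) → j - i ≤ k →
      c i ≠ c j := by
    intro c hc i j hij hev hle heq
    obtain ⟨m, hm⟩ := hev
    refine h.odd m (by omega) (fun t => c (i + t))
      ((hc.isNBWalk hP hN hdis (i + (2 * m + 1))).shift i (2 * m + 1) le_rfl) ?_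
    simp only [add_zero]
    rw [heq]; congr 1; omega
  -- any alternating walk repeats a `P`-edge among the first `k + 1`
  have hrep : ∀ c, IsAlternating P N c → ∃ i j, i < j ∧ j ≤ 2 * k + 1 ∧ Odd i ∧ Odd j ∧
      c i = c (j + 1) ∧ c (i + 1) = c j := by
    intro c hc
    obtain ⟨i, hi, j, hj, hij, heq⟩ := Finset.exists_ne_map_eq_of_card_lt_of_maps_to
      (s := Finset.range (k + 1)) (t := hPfin.toFinset)
      (f := fun i => s(c (2 * i + 1), c (2 * i + 1 + 1))) (by simpa using Nat.lt_succ_of_le hPc)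
      (fun i _ => by
        simpa using hc.memP (2 * i + 1) (odd_two_mul_add_one i))
    wlog hlt : i < j generalizing i j
    · exact this j hj i hi hij.symm heq.symm (by omega)
    simp only [Finset.mem_range] at hi hj
    rcases Sym2.eq_iff.1 heq with h1 | h1
    · exact absurd h1.1 (heven c hc _ _ (by omega) ⟨j - i, by omega⟩ (by omega))
    · exact ⟨2 * i + 1, 2 * j + 1, by omega, by omega, odd_two_mul_add_one i,
        odd_two_mul_add_one j, h1.1, h1.2⟩
  obtain ⟨c₀, hc₀⟩ := exists_isAlternating hPN hNP hne
  have hex : ∃ a, Odd a ∧ a + 1 ≤ 2 * k ∧ ∃ c, IsAlternating P N c ∧ c 0 = c a := by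
    obtain ⟨i, j, hij, hj, hio, hjo, -, h2⟩ := hrep c₀ hc₀
    obtain ⟨x, rfl⟩ := hio
    obtain ⟨y, rfl⟩ := hjo
    refine ⟨2 * y + 1 - (2 * x + 1 + 1), ⟨y - x - 1, by omega⟩, by omega, _,
      hc₀.shift (2 * x + 1 + 1) ⟨x + 1, by omega⟩, ?_⟩
    simp only [add_zero]
    rw [h2]; congr 1; omega
  obtain ⟨hao, hak, c, hc, h0⟩ := Nat.find_spec hex
  have hmin := fun a (ha : a < Nat.find hex) => Nat.find_min hex ha
  set a := Nat.find hex with ha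
  have hka : k < a := by
    by_contra hle
    exact hodd c hc 0 a hao.pos (by simpa using hao) (by omega) h0
  obtain ⟨i, j, hij, hj, hio, hjo, h1, h2⟩ := hrep c hc
  obtain ⟨x, rfl⟩ := hio
  obtain ⟨y, rfl⟩ := hjo
  obtain ⟨z, hz⟩ := hao
  by_cases hja : 2 * y + 1 < a
  · refine hmin (2 * y + 1 - (2 * x + 1 + 1)) (by omega) ⟨⟨y - x - 1, by omega⟩, by omega, _,
      hc.shift (2 * x + 1 + 1) ⟨x + 1, by omega⟩, ?_⟩
    simp only [add_zero]
    rw [h2]; congr 1; omega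
  by_cases hia : a ≤ 2 * x + 1
  · by_cases hxy : 2 * x + 1 + 1 = 2 * y + 1
    · omega
    · exact hodd c hc (2 * x + 1 + 1) (2 * y + 1) (by omega) ⟨y - x - 1, by omega⟩ (by omega) h2
  · have hrev := hc.reverse ⟨z, hz⟩ h0
    refine heven _ hrev (a - (2 * x + 1 + 1)) (2 * y + 1) (by omega) ⟨y + x + 1 - z, by omega⟩
      (by omega) ?_
    simp only [show a - (2 * x + 1 + 1) ≤ a by omega, if_true]
    rw [show a - (a - (2 * x + 1 + 1)) = 2 * x + 1 + 1 by omega, h2]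
    split_ifs with h3
    · rw [show 2 * y + 1 = a by omega, Nat.sub_self, h0]
    · rfl

end alternating

variable [DecidableEq V]

theorem edgeVec_nonneg (e : Sym2 V) (x : V) : 0 ≤ edgeVec e x := by
  induction e with | _ i j
  simp only [edgeVec_mk, Pi.add_apply, Pi.single_apply]
  split_ifs <;> norm_num

theorem edgeVec_pos_iff (e : Sym2 V) (x : V) : 0 < edgeVec e x ↔ x ∈ e := by
  induction e with | _ i j
  simp only [edgeVec_mk, Pi.add_apply, Pi.single_apply, Sym2.mem_iff]
  split_ifs with h1 h2 h2 <;> simp [h1, h2]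

/-- If one of the coefficients at a vertex is positive, then another one is negative. -/
theorem exists_neg_of_dependency [Fintype V] {c : Sym2 V → ℝ}
    (hsum : ∑ e, c e • edgeVec e = 0) {x y : V} (h : 0 < c s(x, y)) : ∃ z, c s(x, z) < 0 := by
  by_contra hno
  push Not at hno
  have h1 : ∑ e, c e * edgeVec e x = 0 := by
    simpa using congrFun hsum x
  have h2 : ∀ e ∈ Finset.univ, 0 ≤ c e * edgeVec e x := by
    intro e _
    by_cases hx : x ∈ e
    · obtain ⟨z, rfl⟩ := hx
      exact mul_nonneg (hno z) (edgeVec_nonneg _ _)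
    · have : edgeVec e x = 0 :=
        le_antisymm (not_lt.1 fun h => hx ((edgeVec_pos_iff e x).1 h)) (edgeVec_nonneg _ _)
      simp [this]
  have h3 := (Finset.sum_eq_zero_iff_of_nonneg h2).1 h1 s(x, y) (Finset.mem_univ _)
  exact (mul_pos h ((edgeVec_pos_iff _ _).2 (Sym2.mem_mk_left x y))).ne' h3

theorem NoShortEvenWalk.isNeighborly [Fintype V] {G : SimpleGraph V} {k : ℕ}
    (h : NoShortEvenWalk G k) : IsNeighborly k (edgePolytope G) := by
  refine isNeighborly_of_forall_dependency fun c hc hsum hcard => ?_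
  have hneg : ∑ e, (-c) e • edgeVec e = 0 := by
    simp [hsum]
  have hN : {e | c e < 0} = ∅ := by
    by_contra hne
    refine h.not_balanced_pair (P := {e | 0 < c e}) (N := {e | c e < 0}) (fun e he => hc e ?_)
      (fun e he => hc e ?_) ?_ (fun x y hxy => exists_neg_of_dependency hsum hxy) ?_
      (Set.nonempty_iff_ne_empty.2 hne) hcard
    · exact ne_of_gt he
    · exact ne_of_lt he
    · exact Set.disjoint_left.2 fun e (h1 : 0 < c e) (h2 : c e < 0) => lt_asymm h1 h2
    · intro x y hxy
      have hxy' : c s(x, y) < 0 := hxy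
      obtain ⟨z, hz⟩ := exists_neg_of_dependency hneg (x := x) (y := y) (by simpa using hxy')
      exact ⟨z, by simpa using hz⟩
  have hP : ∀ e, c e ≤ 0 := by
    intro e
    by_contra hpos
    push Not at hpos
    induction e with | _ x y
    obtain ⟨z, hz⟩ := exists_neg_of_dependency hsum hpos
    exact (Set.ext_iff.1 hN s(x, z)).1 hz
  funext e
  refine le_antisymm (hP e) (not_lt.1 fun h => ?_)
  exact (Set.ext_iff.1 hN e).1 h

/-- Every closed walk of even length whose even-numbered edges take at most `k` values traverses
each edge as often at an even as at an odd position. -/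
def IsBalanced (G : SimpleGraph V) (k : ℕ) : Prop :=
  ∀ (m : ℕ) (w : ℕ → V), (∀ i < 2 * m, G.Adj (w i) (w (i + 1))) → w 0 = w (2 * m) →
    ((Finset.range m).image fun i => s(w (2 * i), w (2 * i + 1))).card ≤ k → ∀ e,
      (∑ i ∈ Finset.range m, if s(w (2 * i), w (2 * i + 1)) = e then 1 else 0) =
        ∑ i ∈ Finset.range m, if s(w (2 * i + 1), w (2 * i + 2)) = e then 1 else 0

/-- The alternating sum of the edge vectors along a closed walk of even length vanishes. -/
theorem IsNeighborly.isBalanced [Fintype V] {G : SimpleGraph V} {k : ℕ}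
    (h : IsNeighborly k (edgePolytope G)) : IsBalanced G k := by
  intro m w hw h0 hcard
  let A : Sym2 V → ℕ := fun e =>
    ∑ i ∈ Finset.range m, if s(w (2 * i), w (2 * i + 1)) = e then 1 else 0
  let B : Sym2 V → ℕ := fun e =>
    ∑ i ∈ Finset.range m, if s(w (2 * i + 1), w (2 * i + 2)) = e then 1 else 0
  have hA : ∀ e, A e ≠ 0 → ∃ i < m, s(w (2 * i), w (2 * i + 1)) = e := by
    intro e he
    obtain ⟨i, hi, hne⟩ := Finset.exists_ne_zero_of_sum_ne_zero he
    exact ⟨i, Finset.mem_range.1 hi, by by_contra hcon; exact hne (if_neg hcon)⟩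
  have hB : ∀ e, B e ≠ 0 → ∃ i < m, s(w (2 * i + 1), w (2 * i + 2)) = e := by
    intro e he
    obtain ⟨i, hi, hne⟩ := Finset.exists_ne_zero_of_sum_ne_zero he
    exact ⟨i, Finset.mem_range.1 hi, by by_contra hcon; exact hne (if_neg hcon)⟩
  have key : (fun e => (A e : ℝ) - B e) = 0 := by
    refine h.eq_zero_of_dependency _ (fun e he => ?_) ?_ ?_
    · by_cases hAe : A e = 0
      · obtain ⟨i, hi, rfl⟩ := hB e (fun hBe => he (by simp [hAe, hBe]))
        exact hw (2 * i + 1) (by omega)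
      · obtain ⟨i, hi, rfl⟩ := hA e hAe
        exact hw (2 * i) (by omega)
    · have h1 : ∀ f : ℕ → Sym2 V, (∑ e, ((∑ i ∈ Finset.range m, if f i = e then 1 else 0 : ℕ) : ℝ)
          • edgeVec e) = ∑ i ∈ Finset.range m, edgeVec (f i) := by
        intro f
        push_cast
        simp only [Finset.sum_smul]
        rw [Finset.sum_comm]
        refine Finset.sum_congr rfl fun i _ => ?_
        simp
      simp only [sub_smul, Finset.sum_sub_distrib]
      rw [h1, h1, ← Finset.sum_sub_distrib]
      have h2 : ∀ i ∈ Finset.range m, edgeVec s(w (2 * i), w (2 * i + 1))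
          - edgeVec s(w (2 * i + 1), w (2 * i + 2))
          = (Pi.single (w (2 * i)) 1 : V → ℝ) - Pi.single (w (2 * (i + 1))) 1 := by
        intro i _
        rw [edgeVec_mk, edgeVec_mk, show 2 * (i + 1) = 2 * i + 2 by ring]
        abel
      rw [Finset.sum_congr rfl h2,
        Finset.sum_range_sub' (fun i => (Pi.single (w (2 * i)) 1 : V → ℝ)), ← h0]
      simp
    · refine le_trans ?_ (Nat.cast_le.2 hcard)
      rw [← Set.encard_coe_eq_coe_finsetCard]
      refine Set.encard_le_encard fun e he => ?_
      have hAe : A e ≠ 0 := by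
        intro h0
        have he' : (0 : ℝ) < A e - B e := he
        rw [h0, Nat.cast_zero, zero_sub, neg_pos] at he'
        exact absurd he' (not_lt.2 (Nat.cast_nonneg _))
      obtain ⟨i, hi, rfl⟩ := hA e hAe
      exact Finset.mem_coe.2 (Finset.mem_image.2 ⟨i, Finset.mem_range.2 hi, rfl⟩)
  intro e
  have := congrFun key e
  simp only [Pi.zero_apply, sub_eq_zero] at this
  exact_mod_cast this

end

/-! ### Counting non-backtracking walks -/

section logarithms

/-- Jensen's inequality for the logarithm, for the uniform weights on a finite set. -/
theorem sum_log_le {ι : Type*} (s : Finset ι) (hs : s.Nonempty) (a : ι → ℝ)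
    (ha : ∀ i ∈ s, 0 < a i) :
    ∑ i ∈ s, Real.log (a i) ≤ s.card * Real.log ((∑ i ∈ s, a i) / s.card) := by
  have hc : (0 : ℝ) < s.card := by exact_mod_cast hs.card_pos
  have hS : 0 < ∑ i ∈ s, a i := Finset.sum_pos ha hs
  set c := (∑ i ∈ s, a i) / s.card with hcdef
  have hcpos : 0 < c := div_pos hS hc
  have h1 : ∀ i ∈ s, Real.log (a i) ≤ Real.log c + (a i / c - 1) := by
    intro i hi
    have := Real.log_le_sub_one_of_pos (div_pos (ha i hi) hcpos)
    rw [Real.log_div (ha i hi).ne' hcpos.ne'] at this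
    linarith
  refine (Finset.sum_le_sum h1).trans ?_
  rw [Finset.sum_add_distrib, Finset.sum_sub_distrib, ← Finset.sum_div]
  have h2 : (∑ i ∈ s, a i) / c = s.card := by
    rw [hcdef]; field_simp
  rw [h2]
  simp

theorem convexOn_mul_log_sub_one :
    ConvexOn ℝ (Set.Ici (2 : ℝ)) (fun x => x * Real.log (x - 1)) := by
  have hd : ∀ x : ℝ, 2 < x →
      HasDerivAt (fun x => x * Real.log (x - 1)) (Real.log (x - 1) + x / (x - 1)) x := by
    intro x hx
    have h1 : HasDerivAt (fun x : ℝ => x - 1) 1 x := (hasDerivAt_id x).sub_const 1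
    refine ((hasDerivAt_id' x).mul (h1.log (by linarith))).congr_deriv ?_
    rw [one_mul, mul_one_div]
  refine MonotoneOn.convexOn_of_deriv (convex_Ici 2) ?_ ?_ ?_
  · refine continuousOn_id.mul (ContinuousOn.log (by fun_prop) fun x hx => ?_)
    have : (2 : ℝ) ≤ x := hx
    linarith
  · rw [interior_Ici]
    exact fun x hx => (hd x hx).differentiableAt.differentiableWithinAt
  · rw [interior_Ici]
    intro x hx y hy hxy
    have hx' : (2 : ℝ) < x := hx
    have hy' : (2 : ℝ) < y := hy
    rw [(hd x hx).deriv, (hd y hy).deriv]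
    have hx1 : 0 < x - 1 := by linarith
    have hy1 : 0 < y - 1 := by linarith
    have h1 := Real.log_le_sub_one_of_pos (div_pos hx1 hy1)
    rw [Real.log_div hx1.ne' hy1.ne'] at h1
    have h2 : x / (x - 1) - y / (y - 1) ≤ 1 - (x - 1) / (y - 1) := by
      rw [div_sub_div _ _ hx1.ne' hy1.ne', one_sub_div hy1.ne', div_le_div_iff₀ (by positivity) hy1]
      nlinarith [mul_nonneg (mul_nonneg (sub_nonneg.2 hxy) hy1.le) (show 0 ≤ x - 2 by linarith)]
    linarith

end logarithms

section
variable {W : Type*}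

/-- Every closed non-backtracking walk of even length at most `2k` has length `2k` and goes twice
around a closed walk of length `k`. -/
def AlmostNoShortEvenWalk (G : SimpleGraph W) (k : ℕ) : Prop :=
  ∀ m, 1 ≤ m → m ≤ k → ∀ w, IsNBWalk G (2 * m) w → w 0 = w (2 * m) → m = k ∧ w k = w 0

theorem AlmostNoShortEvenWalk.unique {G : SimpleGraph W} {k : ℕ} (hG : AlmostNoShortEvenWalk G k)
    (r : ℕ) : r ≤ k → ∀ w w', IsNBWalk G r w → IsNBWalk G r w' → w 0 = w' 0 → w r = w' r →
      (∀ i ≤ r, w i = w' i) ∨ (r = k ∧ w r = w 0) := by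
  induction r with
  | zero =>
    intro _ w w' _ _ h0 _
    left
    intro i hi
    rwa [Nat.le_zero.1 hi]
  | succ r ih =>
    intro hr w w' hw hw' h0 h1
    by_cases h2 : w r = w' r
    · rcases ih (by omega) w w' (by simpa using hw.shift 0 r (by omega))
        (by simpa using hw'.shift 0 r (by omega)) h0 h2 with h3 | h3
      · left
        intro i hi
        rcases Nat.le_succ_iff.1 hi with h4 | h4
        · exact h3 i h4
        · rw [h4]; exact h1
      · omega
    · right
      -- follow `w` and then return along `w'`
      set s := r + 1 with hs
      have key := hG s (by omega) hr (fun i => if i ≤ s then w i else w' (2 * s - i)) ⟨?_, ?_⟩ ?_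
      · refine ⟨key.1, ?_⟩
        have h5 := key.2
        simp only [← key.1, le_refl, if_true, Nat.zero_le] at h5
        exact h5
      · intro i hi
        by_cases h3 : i < s
        · simpa [h3.le, Nat.succ_le_of_lt h3] using hw.adj i h3
        · have h4 := (hw'.adj (2 * s - (i + 1)) (by omega)).symm
          rw [show 2 * s - (i + 1) + 1 = 2 * s - i by omega] at h4
          by_cases h5 : i = s
          · subst h5
            rw [show 2 * s - s = s by omega, ← h1] at h4
            simpa using h4
          · simpa [show ¬ i ≤ s by omega, show ¬ i + 1 ≤ s by omega] using h4
      · intro i hi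
        by_cases h3 : i + 2 ≤ s
        · simpa [h3, show i ≤ s by omega] using hw.ne i h3
        · by_cases h4 : i + 1 = s
          · simp only [show i ≤ s by omega, h3, if_true, if_false]
            rw [show 2 * s - (i + 2) = r by omega, show i = r by omega]
            exact h2
          · have h5 := (hw'.ne (2 * s - (i + 2)) (by omega)).symm
            rw [show 2 * s - (i + 2) + 2 = 2 * s - i by omega] at h5
            by_cases h6 : i = s
            · subst h6
              rw [show 2 * s - s = s by omega, ← h1] at h5
              simpa using h5
            · simpa [show ¬ i ≤ s by omega, h3] using h5
      · simp only [Nat.zero_le, if_true, show ¬ 2 * s ≤ s by omega, if_false, Nat.sub_self]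
        exact h0

variable [Fintype W]

open Classical in
/-- The end points of the non-backtracking walks of length `r` whose first step goes from `u` to
`v`. -/
noncomputable def nbEnds (G : SimpleGraph W) (r : ℕ) (u v : W) : Finset W :=
  Finset.univ.filter fun x => ∃ w, IsNBWalk G r w ∧ w 0 = u ∧ w 1 = v ∧ w r = x

theorem mem_nbEnds {G : SimpleGraph W} {r : ℕ} {u v x : W} :
    x ∈ nbEnds G r u v ↔ ∃ w, IsNBWalk G r w ∧ w 0 = u ∧ w 1 = v ∧ w r = x := by
  simp [nbEnds]

theorem nbEnds_one {G : SimpleGraph W} {u v : W} (h : G.Adj u v) : nbEnds G 1 u v = {v} := by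
  ext x
  rw [mem_nbEnds, Finset.mem_singleton]
  constructor
  · rintro ⟨w, -, -, h1, h2⟩
    rw [← h1, ← h2]
  · rintro rfl
    refine ⟨fun i => if i = 0 then u else x, ⟨fun i hi => ?_, fun i hi => by omega⟩, ?_⟩
    · simpa [show i = 0 by omega] using h
    · simp

theorem disjoint_nbEnds {G : SimpleGraph W} {k : ℕ} (hG : AlmostNoShortEvenWalk G k) {r : ℕ} (hr : 1 ≤ r) (hrk : r ≤ k)
    {u v v' x : W} (hvv : v ≠ v') (h : x ∈ nbEnds G r u v) (h' : x ∈ nbEnds G r u v') :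
    r = k ∧ x = u := by
  rw [mem_nbEnds] at h h'
  obtain ⟨w, hw, h0, h1, h2⟩ := h
  obtain ⟨w', hw', h0', h1', h2'⟩ := h'
  rcases hG.unique r hrk w w' hw hw' (by rw [h0, h0']) (by rw [h2, h2']) with h3 | h3
  · exact absurd (by rw [← h1, ← h1', h3 1 hr]) hvv
  · exact ⟨h3.1, by rw [← h2, ← h0, h3.2]⟩

section
variable {G : SimpleGraph W} [DecidableEq W] [DecidableRel G.Adj] {k : ℕ}

theorem nbEnds_succ {r : ℕ} (hr : 1 ≤ r) {u v : W} (h : G.Adj u v) :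
    nbEnds G (r + 1) u v = ((G.neighborFinset v).erase u).biUnion (nbEnds G r v) := by
  ext x
  simp only [mem_nbEnds, Finset.mem_biUnion, Finset.mem_erase, SimpleGraph.mem_neighborFinset]
  constructor
  · rintro ⟨w, hw, h0, h1, h2⟩
    refine ⟨w 2, ⟨?_, ?_⟩, fun i => w (1 + i), hw.shift 1 r (by omega), h1, rfl, ?_⟩
    · rw [← h0]; exact (hw.ne 0 (by omega)).symm
    · rw [← h1]; exact hw.adj 1 (by omega)
    · rw [← h2, add_comm]
  · rintro ⟨y, ⟨hy, hvy⟩, w, hw, h0, h1, h2⟩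
    refine ⟨fun i => Nat.casesOn i u w, ⟨fun i hi => ?_, fun i hi => ?_⟩, rfl, h0, h2⟩
    · cases i with
      | zero => show G.Adj u (w 0); rwa [h0]
      | succ i => exact hw.adj i (by omega)
    · cases i with
      | zero => show u ≠ w 1; rw [h1]; exact hy.symm
      | succ i => exact hw.ne i (by omega)

theorem card_nbEnds_succ (hG : AlmostNoShortEvenWalk G k) {r : ℕ} (hr : 1 ≤ r) (hrk : r + 1 ≤ k)
    {u v : W} (h : G.Adj u v) : (nbEnds G (r + 1) u v).card =
      ∑ x ∈ (G.neighborFinset v).erase u, (nbEnds G r v x).card := by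
  rw [nbEnds_succ hr h, Finset.card_biUnion]
  intro x _ y _ hxy
  rw [Function.onFun, Finset.disjoint_left]
  intro z hz hz'
  have := (disjoint_nbEnds hG hr (by omega) hxy hz hz').1
  omega

/-- The walks of length `k` from `u` have distinct end points, except that for `k ≥ 3` several of
them may return to `u`. -/
theorem sum_card_nbEnds_le (hG : AlmostNoShortEvenWalk G k) (hk : 2 ≤ k) (u : W) :
    ∑ v ∈ G.neighborFinset u, (nbEnds G k u v).card
      ≤ Fintype.card W + (k - 2) * G.degree u := by
  have h1 : ∀ v, (nbEnds G k u v).card ≤ ((nbEnds G k u v).erase u).card + (k - 2) := by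
    intro v
    by_cases hu : u ∈ nbEnds G k u v
    · have h3 : 3 ≤ k := by
        by_contra hlt
        obtain ⟨w, hw, h0, -, h2⟩ := mem_nbEnds.1 hu
        have := hw.ne 0 (by omega)
        rw [h0, ← h2] at this
        exact this (by congr 1; omega)
      rw [Finset.card_erase_of_mem hu]
      omega
    · rw [Finset.erase_eq_of_notMem hu]
      omega
  refine (Finset.sum_le_sum fun v _ => h1 v).trans ?_
  rw [Finset.sum_add_distrib, Finset.sum_const, G.card_neighborFinset_eq_degree, smul_eq_mul,
    mul_comm (G.degree u)]
  gcongr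
  rw [← Finset.card_biUnion]
  · exact Finset.card_le_univ _
  · intro x _ y _ hxy
    rw [Function.onFun, Finset.disjoint_left]
    intro z hz hz'
    rw [Finset.mem_erase] at hz hz'
    exact hz.1 (disjoint_nbEnds hG (by omega) le_rfl hxy hz.2 hz'.2).2

theorem card_nbEnds_pos (hG : AlmostNoShortEvenWalk G k) (hdeg : ∀ v, 2 ≤ G.degree v) {r : ℕ}
    (hr : 1 ≤ r) : r ≤ k → ∀ u v, G.Adj u v → 0 < (nbEnds G r u v).card := by
  induction r, hr using Nat.le_induction with
  | base => intro _ u v h; simp [nbEnds_one h]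
  | succ r hr ih =>
    intro hrk u v h
    rw [card_nbEnds_succ hG hr hrk h]
    have hmem : u ∈ G.neighborFinset v := by simpa using h.symm
    refine Finset.sum_pos (fun x hx => ih (by omega) v x ?_) ?_
    · simpa using (Finset.mem_erase.1 hx).2
    · rw [← Finset.card_pos, Finset.card_erase_of_mem hmem, G.card_neighborFinset_eq_degree]
      have := hdeg v
      omega

/-- Along a non-backtracking random walk the uniform distribution on darts is stationary; this is
the induction step of the entropy bound for the number of such walks. -/
theorem sum_log_card_nbEnds_ge (hG : AlmostNoShortEvenWalk G k) (hdeg : ∀ v, 2 ≤ G.degree v)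
    {r : ℕ} (hr : 1 ≤ r) : r ≤ k →
      ((r : ℝ) - 1) * ∑ v, (G.degree v : ℝ) * Real.log (G.degree v - 1)
        ≤ ∑ u, ∑ v ∈ G.neighborFinset u, Real.log (nbEnds G r u v).card := by
  induction r, hr using Nat.le_induction with
  | base =>
    intro _
    rw [Nat.cast_one, sub_self, zero_mul]
    exact Finset.sum_nonneg fun u _ => Finset.sum_nonneg fun v _ => Real.log_natCast_nonneg _
  | succ r hr ih =>
    intro hrk
    have hstep : ∀ v, ∀ u ∈ G.neighborFinset v, Real.log (G.degree v - 1) +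
        (∑ x ∈ (G.neighborFinset v).erase u, Real.log (nbEnds G r v x).card) / (G.degree v - 1)
          ≤ Real.log (nbEnds G (r + 1) u v).card := by
      intro v u hu
      have huv : G.Adj u v := by simpa using ((G.mem_neighborFinset v u).1 hu).symm
      have hd : (2 : ℝ) ≤ G.degree v := by exact_mod_cast hdeg v
      have hcard : (((G.neighborFinset v).erase u).card : ℝ) = G.degree v - 1 := by
        rw [Finset.card_erase_of_mem hu, G.card_neighborFinset_eq_degree,
          Nat.cast_sub (by have := hdeg v; omega), Nat.cast_one]
      have hne : ((G.neighborFinset v).erase u).Nonempty := by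
        rw [← Finset.card_pos, ← Nat.cast_pos (α := ℝ), hcard]
        linarith
      have hpos : ∀ x ∈ (G.neighborFinset v).erase u, (0 : ℝ) < (nbEnds G r v x).card := by
        intro x hx
        exact_mod_cast card_nbEnds_pos hG hdeg hr (by omega) v x
          (by simpa using (Finset.mem_erase.1 hx).2)
      have h1 := sum_log_le _ hne _ hpos
      rw [hcard, ← Nat.cast_sum, ← card_nbEnds_succ hG hr hrk huv,
        Real.log_div (by exact_mod_cast (card_nbEnds_pos hG hdeg (by omega) hrk u v huv).ne')
          (by linarith)] at h1
      rw [← le_sub_iff_add_le', div_le_iff₀ (by linarith)]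
      linarith
    have hswap : ∀ F : W → W → ℝ, ∑ u, ∑ v ∈ G.neighborFinset u, F u v
        = ∑ v, ∑ u ∈ G.neighborFinset v, F u v := by
      intro F
      exact Finset.sum_comm' (by simp [G.adj_comm])
    rw [hswap]
    have hv : ∀ v ∈ Finset.univ, (G.degree v : ℝ) * Real.log (G.degree v - 1) +
        ∑ x ∈ G.neighborFinset v, Real.log (nbEnds G r v x).card
          ≤ ∑ u ∈ G.neighborFinset v, Real.log (nbEnds G (r + 1) u v).card := by
      intro v _
      refine le_trans (le_of_eq ?_) (Finset.sum_le_sum (hstep v))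
      have hd : (2 : ℝ) ≤ G.degree v := by exact_mod_cast hdeg v
      have hd' : (G.degree v : ℝ) - 1 ≠ 0 := by linarith
      rw [Finset.sum_add_distrib, ← Finset.sum_div, Finset.sum_const,
        G.card_neighborFinset_eq_degree, nsmul_eq_mul]
      congr 1
      rw [eq_div_iff hd']
      have h2 : ∀ u ∈ G.neighborFinset v,
          ∑ x ∈ (G.neighborFinset v).erase u, Real.log (nbEnds G r v x).card
          = (∑ x ∈ G.neighborFinset v, Real.log (nbEnds G r v x).card)
            - Real.log (nbEnds G r v u).card := fun u hu => Finset.sum_erase_eq_sub hu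
      rw [Finset.sum_congr rfl h2, Finset.sum_sub_distrib, Finset.sum_const,
        G.card_neighborFinset_eq_degree, nsmul_eq_mul]
      ring
    refine le_trans ?_ (Finset.sum_le_sum hv)
    rw [Finset.sum_add_distrib]
    have := ih (by omega)
    push_cast
    linarith

/-- The Moore bound for irregular graphs: `d` is the average degree. -/
theorem AlmostNoShortEvenWalk.moore_bound [Nonempty W] (hG : AlmostNoShortEvenWalk G k)
    (hk : 2 ≤ k) (hdeg : ∀ v, 2 ≤ G.degree v) (d : ℝ)
    (hd : d * Fintype.card W = ∑ v, (G.degree v : ℝ)) :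
    2 ≤ d ∧ d * (d - 1) ^ (k - 1) ≤ Fintype.card W + ((k : ℝ) - 2) * d := by
  set n : ℝ := (Fintype.card W : ℝ) with hn
  have hn0 : 0 < n := by rw [hn]; exact_mod_cast Fintype.card_pos
  have hdeg' : ∀ v, (2 : ℝ) ≤ G.degree v := fun v => by exact_mod_cast hdeg v
  have hd2 : 2 ≤ d := by
    have h1 : ∑ _v : W, (2 : ℝ) ≤ ∑ v, (G.degree v : ℝ) := Finset.sum_le_sum fun v _ => hdeg' v
    rw [← hd, Finset.sum_const, Finset.card_univ, nsmul_eq_mul, mul_comm] at h1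
    exact le_of_mul_le_mul_right h1 hn0
  refine ⟨hd2, ?_⟩
  have hD : 0 < d * n := mul_pos (by linarith) hn0
  have hconv : d * n * Real.log (d - 1) ≤ ∑ v, (G.degree v : ℝ) * Real.log (G.degree v - 1) := by
    have h1 := convexOn_mul_log_sub_one.map_sum_le (t := Finset.univ) (w := fun _ : W => n⁻¹)
      (p := fun v => (G.degree v : ℝ)) (fun _ _ => (inv_pos.2 hn0).le)
      (by rw [Finset.sum_const, Finset.card_univ, nsmul_eq_mul]; exact mul_inv_cancel₀ hn0.ne')
      (fun v _ => hdeg' v)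
    simp only [smul_eq_mul, ← Finset.mul_sum] at h1
    rw [← hd, mul_comm d n, inv_mul_cancel_left₀ hn0.ne', le_inv_mul_iff₀ hn0] at h1
    linarith
  let S : Finset (Σ _ : W, W) := Finset.univ.sigma fun u => G.neighborFinset u
  have hScard : (S.card : ℝ) = d * n := by
    rw [Finset.card_sigma]; push_cast
    simp only [G.card_neighborFinset_eq_degree]
    exact hd.symm
  have hSne : S.Nonempty := by
    rw [← Finset.card_pos, ← Nat.cast_pos (α := ℝ), hScard]; exact hD
  have hpos : ∀ p ∈ S, (0 : ℝ) < (nbEnds G k p.1 p.2).card := by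
    intro p hp
    exact_mod_cast card_nbEnds_pos hG hdeg (by omega) le_rfl p.1 p.2
      (by simpa using (Finset.mem_sigma.1 hp).2)
  have hjen := sum_log_le S hSne (fun p => ((nbEnds G k p.1 p.2).card : ℝ)) hpos
  have hlow := sum_log_card_nbEnds_ge hG hdeg (r := k) (by omega) le_rfl
  rw [← Finset.sum_sigma (s := Finset.univ) (t := fun u => G.neighborFinset u)
    (f := fun p : (Σ _ : W, W) => Real.log (nbEnds G k p.1 p.2).card)] at hlow
  set T : ℝ := ∑ p ∈ S, ((nbEnds G k p.1 p.2).card : ℝ) with hT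
  have hTpos : 0 < T := Finset.sum_pos hpos hSne
  have hTle : T ≤ n * n + (k - 2) * (d * n) := by
    have h1 : (∑ p ∈ S, (nbEnds G k p.1 p.2).card)
        ≤ ∑ u : W, (Fintype.card W + (k - 2) * G.degree u) := by
      rw [Finset.sum_sigma]
      exact Finset.sum_le_sum fun u _ => sum_card_nbEnds_le hG hk u
    have h2 : T ≤ ∑ u : W, ((Fintype.card W : ℝ) + (k - 2) * G.degree u) := by
      have h3 : ((∑ p ∈ S, (nbEnds G k p.1 p.2).card : ℕ) : ℝ)
        ≤ ((∑ u : W, (Fintype.card W + (k - 2) * G.degree u) : ℕ) : ℝ) := by exact_mod_cast h1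
      push_cast [Nat.cast_sub hk] at h3
      exact h3
    rw [Finset.sum_add_distrib, Finset.sum_const, Finset.card_univ, nsmul_eq_mul, ← Finset.mul_sum,
      ← hd] at h2
    exact h2
  rw [hScard] at hjen
  have hk1 : (1 : ℝ) ≤ k := by exact_mod_cast (by omega : 1 ≤ k)
  have h1 : ((k : ℝ) - 1) * Real.log (d - 1) ≤ Real.log (T / (d * n)) := by
    have h2 : ((k : ℝ) - 1) * (d * n * Real.log (d - 1)) ≤ d * n * Real.log (T / (d * n)) :=
      (mul_le_mul_of_nonneg_left hconv (by linarith)).trans (hlow.trans hjen)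
    have h3 : d * n * (((k : ℝ) - 1) * Real.log (d - 1)) ≤ d * n * Real.log (T / (d * n)) := by
      linarith
    exact le_of_mul_le_mul_left h3 hD
  have h2 : (d - 1) ^ (k - 1) ≤ T / (d * n) := by
    rw [← Real.log_le_log_iff (pow_pos (by linarith) _) (div_pos hTpos hD), Real.log_pow,
      Nat.cast_sub (by omega), Nat.cast_one]
    exact h1
  rw [le_div_iff₀ hD] at h2
  have h3 : n * (d * (d - 1) ^ (k - 1)) ≤ n * (n + (k - 2) * d) := by linarith
  exact le_of_mul_le_mul_left h3 hn0

end
end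

/-! ### Short odd closed walks in balanced graphs -/

section
variable {W : Type*}

/-- No closed walk of odd length less than `k`. -/
def NoShortOddWalk (G : SimpleGraph W) (k : ℕ) : Prop :=
  ∀ a, Odd a → a < k → ∀ w : ℕ → W, (∀ i < a, G.Adj (w i) (w (i + 1))) → w 0 ≠ w a

theorem NoShortOddWalk.induce {G : SimpleGraph W} {k : ℕ} (h : NoShortOddWalk G k) (A : Set W) :
    NoShortOddWalk (G.induce A) k :=
  fun a ha hak w hw h0 => h a ha hak (fun i => (w i : W)) (fun i hi => hw i hi)
    (congrArg Subtype.val h0)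

variable [DecidableEq W]

theorem IsBalanced.mono {G G' : SimpleGraph W} {k : ℕ} (h : IsBalanced G k) (hle : G' ≤ G) :
    IsBalanced G' k :=
  fun m w hw => h m w fun i hi => hle (hw i hi)

theorem IsBalanced.induce {G : SimpleGraph W} {k : ℕ} (h : IsBalanced G k) (A : Set W) :
    IsBalanced (G.induce A) k := by
  intro m w hw h0 hcard e
  have hinj : Function.Injective (Sym2.map (Subtype.val : A → W)) :=
    Sym2.map.injective Subtype.val_injective
  have h1 := h m (fun i => (w i : W)) (fun i hi => hw i hi) (congrArg Subtype.val h0) ?_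
    (Sym2.map Subtype.val e)
  · simp only [← Sym2.map_mk, hinj.eq_iff] at h1
    exact h1
  · refine le_trans (le_of_eq ?_) hcard
    rw [← Finset.card_image_of_injective _ hinj, Finset.image_image]
    rfl

/-- In a balanced graph the closed non-backtracking walks of even length at most `2k` come from
short odd closed walks. -/
theorem IsBalanced.almostNoShortEvenWalk {G : SimpleGraph W} {k : ℕ} (h : IsBalanced G k)
    (hodd : NoShortOddWalk G k) : AlmostNoShortEvenWalk G k := by
  intro m
  induction m using Nat.strong_induction_on with
  | _ m ih =>
    intro hm hmk w hw h0
    have hb := h m w hw.adj h0 (Finset.card_image_le.trans (by simpa using hmk)) s(w 0, w 1)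
    -- the first edge is also traversed at an odd position
    obtain ⟨i, hi, heq⟩ : ∃ i < m, s(w (2 * i + 1), w (2 * i + 2)) = s(w 0, w 1) := by
      by_contra hno
      push Not at hno
      rw [Finset.sum_eq_zero (s := Finset.range m)
        (f := fun i => if s(w (2 * i + 1), w (2 * i + 2)) = s(w 0, w 1) then 1 else 0)
        (fun i hi => if_neg (hno i (Finset.mem_range.1 hi)))] at hb
      have := (Finset.sum_eq_zero_iff.1 hb) 0 (Finset.mem_range.2 (by omega))
      simp at this
    rcases Sym2.eq_iff.1 heq with ⟨h1, -⟩ | ⟨h1, h2⟩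
    · have h3 : k ≤ 2 * i + 1 := by
        by_contra hlt
        exact hodd (2 * i + 1) (odd_two_mul_add_one i) (by omega) w
          (fun j hj => hw.adj j (by omega)) h1.symm
      have h4 : k ≤ 2 * m - (2 * i + 1) := by
        by_contra hlt
        refine hodd (2 * m - (2 * i + 1)) ⟨m - i - 1, by omega⟩ (by omega)
          (fun j => w (2 * i + 1 + j)) (fun j hj => hw.adj _ (by omega)) ?_
        simp only [add_zero]
        rw [h1, h0]; congr 1; omega
      refine ⟨by omega, ?_⟩
      rw [← h1]; congr 1; omega
    · by_cases h3 : i + 1 = m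
      · by_cases h4 : m = 1
        · exact absurd h2.symm (by simpa [show i = 0 by omega] using hw.ne 0 (by omega))
        · have := (ih (m - 1) (by omega) (by omega) (by omega) _
            (hw.shift 1 (2 * (m - 1)) (by omega)) (by
              simp only [add_zero]
              rw [← h1]; congr 1; omega)).1
          omega
      · have := (ih (i + 1) (by omega) (by omega) (by omega) w
          (by simpa using hw.shift 0 (2 * (i + 1)) (by omega)) h2.symm).1
        omega

/-- The set of edges that are traversed an odd number of times by the first `a` steps of `w`,
as a vector over the field with two elements. -/
def parityVec (w : ℕ → W) (a : ℕ) (e : Sym2 W) : ZMod 2 :=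
  ∑ i ∈ Finset.range a, if s(w i, w (i + 1)) = e then 1 else 0

theorem parityVec_eq_zero_of_isBalanced {G : SimpleGraph W} {k m : ℕ} (h : IsBalanced G k)
    {w : ℕ → W} (hw : ∀ i < 2 * m, G.Adj (w i) (w (i + 1))) (h0 : w 0 = w (2 * m))
    (hcard : ((Finset.range m).image fun i => s(w (2 * i), w (2 * i + 1))).card ≤ k) :
    parityVec w (2 * m) = 0 := by
  funext e
  have key : ∀ (f : ℕ → ZMod 2) (m : ℕ), ∑ i ∈ Finset.range (2 * m), f i
      = ∑ i ∈ Finset.range m, f (2 * i) + ∑ i ∈ Finset.range m, f (2 * i + 1) := by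
    intro f m
    induction m with
    | zero => simp
    | succ m ih =>
      rw [show 2 * (m + 1) = 2 * m + 1 + 1 by ring, Finset.sum_range_succ, Finset.sum_range_succ,
        ih, Finset.sum_range_succ, Finset.sum_range_succ]
      ring
  have hb := congrArg (Nat.cast : ℕ → ZMod 2) (h m w hw h0 hcard e)
  push_cast at hb
  unfold parityVec
  rw [key, hb]
  exact CharTwo.add_self_eq_zero _

/-- Two short odd closed walks whose base points have a common neighbor traverse the same edges
modulo two: joining them through that neighbor gives a balanced walk. -/
theorem IsBalanced.parityVec_eq {G : SimpleGraph W} {k : ℕ} (h : IsBalanced G k) {a b : ℕ}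
    (ha : Odd a) (hak : a < k) (hb : Odd b) (hbk : b < k) {c c' : ℕ → W}
    (hc : ∀ i < a, G.Adj (c i) (c (i + 1))) (hc0 : c 0 = c a)
    (hc' : ∀ i < b, G.Adj (c' i) (c' (i + 1))) (hc0' : c' 0 = c' b) {z : W}
    (hz : G.Adj z (c 0)) (hz' : G.Adj z (c' 0)) : parityVec c a = parityVec c' b := by
  obtain ⟨x, rfl⟩ := ha
  obtain ⟨y, rfl⟩ := hb
  set a := 2 * x + 1 with ha
  set b := 2 * y + 1 with hb
  let w : ℕ → W := fun i => if i ≤ a then c i else if i = a + 1 then z else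
    if i ≤ a + 2 + b then c' (i - (a + 2)) else if i = a + 2 + b + 1 then z else c 0
  have e1 : ∀ i < a, s(w i, w (i + 1)) = s(c i, c (i + 1)) := by
    intro i hi
    simp only [w, hi.le, Nat.succ_le_of_lt hi, if_true]
  have e2 : s(w a, w (a + 1)) = s(z, c 0) := by
    simp only [w, le_refl, show ¬ a + 1 ≤ a by omega, if_true, if_false]
    rw [← hc0, Sym2.eq_swap]
  have e3 : s(w (a + 1), w (a + 2)) = s(z, c' 0) := by
    simp only [w, show ¬ a + 1 ≤ a by omega, show ¬ a + 2 ≤ a by omega,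
      show ¬ a + 2 = a + 1 by omega, show a + 2 ≤ a + 2 + b by omega, if_true, if_false,
      Nat.sub_self]
  have e4 : ∀ j < b, s(w (a + 2 + j), w (a + 2 + j + 1)) = s(c' j, c' (j + 1)) := by
    intro j hj
    simp only [w, show ¬ a + 2 + j ≤ a by omega, show ¬ a + 2 + j = a + 1 by omega,
      show a + 2 + j ≤ a + 2 + b by omega, show ¬ a + 2 + j + 1 ≤ a by omega,
      show ¬ a + 2 + j + 1 = a + 1 by omega, show a + 2 + j + 1 ≤ a + 2 + b by omega,
      if_true, if_false]
    rw [show a + 2 + j - (a + 2) = j by omega, show a + 2 + j + 1 - (a + 2) = j + 1 by omega]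
  have e5 : s(w (a + 2 + b), w (a + 2 + b + 1)) = s(z, c' 0) := by
    simp only [w, show ¬ a + 2 + b ≤ a by omega, show ¬ a + 2 + b = a + 1 by omega,
      le_refl, show ¬ a + 2 + b + 1 ≤ a by omega,
      show ¬ a + 2 + b + 1 = a + 1 by omega, show ¬ a + 2 + b + 1 ≤ a + 2 + b by omega,
      if_true, if_false]
    rw [show a + 2 + b - (a + 2) = b by omega, ← hc0', Sym2.eq_swap]
  have e6 : s(w (a + 2 + b + 1), w (a + 2 + b + 2)) = s(z, c 0) := by
    simp only [w, show ¬ a + 2 + b + 2 ≤ a by omega, show ¬ a + 2 + b + 2 = a + 1 by omega,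
      show ¬ a + 2 + b + 1 ≤ a by omega,
      show ¬ a + 2 + b + 1 = a + 1 by omega, show ¬ a + 2 + b + 1 ≤ a + 2 + b by omega,
      show ¬ a + 2 + b + 2 ≤ a + 2 + b by omega,
      show ¬ a + 2 + b + 2 = a + 2 + b + 1 by omega,
      if_true, if_false]
  have hadj : ∀ i < 2 * (x + y + 3), s(w i, w (i + 1)) ∈ G.edgeSet := by
    intro i hi
    by_cases h1 : i < a
    · rw [e1 i h1]; exact hc i h1
    by_cases h2 : i = a
    · rw [h2, e2]; exact hz
    by_cases h3 : i = a + 1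
    · rw [h3, e3]; exact hz'
    by_cases h4 : i < a + 2 + b
    · have h5 := e4 (i - (a + 2)) (by omega)
      rw [show a + 2 + (i - (a + 2)) = i by omega] at h5
      rw [h5]; exact hc' _ (by omega)
    by_cases h5 : i = a + 2 + b
    · rw [h5, e5]; exact hz'
    · rw [show i = a + 2 + b + 1 by omega, e6]; exact hz
  have h2m : 2 * (x + y + 3) = a + 2 + b + 2 := by omega
  have hzero := parityVec_eq_zero_of_isBalanced (m := x + y + 3) h hadj ?_ ?_
  · -- the two edges at `z` are each traversed twice
    funext e
    have h1 := congrFun hzero e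
    rw [h2m] at h1
    unfold parityVec at h1 ⊢
    rw [Finset.sum_range_add, Finset.sum_range_add, Finset.sum_range_add] at h1
    rw [Finset.sum_congr rfl fun i hi => by rw [e1 i (Finset.mem_range.1 hi)],
      Finset.sum_congr (s₁ := Finset.range b) rfl
        fun i hi => by rw [e4 i (Finset.mem_range.1 hi)]] at h1
    simp only [Finset.sum_range_succ, Finset.sum_range_zero, zero_add, add_zero] at h1
    rw [e2, e3, e5, e6] at h1
    simp only [Pi.zero_apply] at h1
    generalize (if s(z, c 0) = e then (1 : ZMod 2) else 0) = p at h1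
    generalize (if s(z, c' 0) = e then (1 : ZMod 2) else 0) = q at h1
    generalize (∑ i ∈ Finset.range a, if s(c i, c (i + 1)) = e then (1 : ZMod 2) else 0) = s at *
    generalize (∑ i ∈ Finset.range b, if s(c' i, c' (i + 1)) = e then (1 : ZMod 2) else 0) = t at *
    revert h1
    revert p q s t
    decide
  · rw [h2m]
    simp only [w, Nat.zero_le, if_true, show ¬ a + 2 + b + 2 ≤ a by omega,
      show ¬ a + 2 + b + 2 = a + 1 by omega, show ¬ a + 2 + b + 2 ≤ a + 2 + b by omega,
      show ¬ a + 2 + b + 2 = a + 2 + b + 1 by omega, if_false]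
  · rw [show x + y + 3 = x + y + 2 + 1 by rfl, Finset.range_add_one, Finset.image_insert,
      Finset.insert_eq_self.2]
    · refine Finset.card_image_le.trans ?_
      rw [Finset.card_range]
      omega
    · refine Finset.mem_image.2 ⟨x + 1, Finset.mem_range.2 (by omega), ?_⟩
      rw [show 2 * (x + 1) = a + 1 by omega, show 2 * (x + y + 2) = a + 2 + b by omega]
      exact e3.trans e5.symm

theorem sum_parityVec [Fintype W] (w : ℕ → W) (a : ℕ) : ∑ e, parityVec w a e = a := by
  unfold parityVec
  rw [Finset.sum_comm]
  simp

/-- Deleting few edges from a balanced graph of large minimum degree destroys all short odd closed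
walks: it suffices to delete one edge for each parity vector of such a walk, and the neighborhoods
of base points that belong to different vectors are disjoint. -/
theorem IsBalanced.exists_noShortOddWalk [Fintype W] {G : SimpleGraph W} [DecidableRel G.Adj]
    {k : ℕ} (h : IsBalanced G k) {τ : ℝ} (hτ : 0 < τ) (hdeg : ∀ v, τ ≤ G.degree v) :
    ∃ G' ≤ G, NoShortOddWalk G' k ∧
      (G.edgeSet.ncard : ℝ) ≤ G'.edgeSet.ncard + Fintype.card W / τ := by
  classical
  let Q : (Sym2 W → ZMod 2) → ℕ → (ℕ → W) → Prop := fun p a w => Odd a ∧ a < k ∧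
    (∀ i < a, G.Adj (w i) (w (i + 1))) ∧ w 0 = w a ∧ parityVec w a = p
  let Pv : Finset (Sym2 W → ZMod 2) := Finset.univ.filter fun p => ∃ a w, Q p a w
  have hPv : ∀ p, p ∈ Pv ↔ ∃ a w, Q p a w := fun p => by simp [Pv]
  have hbase : ∀ p : Pv, ∃ x, ∃ a w, Q p a w ∧ w 0 = x := fun p => by
    obtain ⟨a, w, hw⟩ := (hPv p).1 p.2
    exact ⟨_, a, w, hw, rfl⟩
  have hedge : ∀ p : Pv, ∃ e, (p : Sym2 W → ZMod 2) e ≠ 0 := fun p => by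
    obtain ⟨a, w, ha, -, -, -, hp⟩ := (hPv p).1 p.2
    by_contra hno
    push Not at hno
    have h1 := sum_parityVec w a
    rw [hp, Finset.sum_eq_zero fun e _ => hno e] at h1
    obtain ⟨b, rfl⟩ := ha
    have h2 : (2 : ZMod 2) = 0 := rfl
    push_cast at h1
    rw [h2, zero_mul, zero_add] at h1
    exact zero_ne_one h1
  choose x hx using hbase
  choose e he using hedge
  let E : Finset (Sym2 W) := Finset.univ.image e
  refine ⟨G.deleteEdges E, G.deleteEdges_le _, ?_, ?_⟩
  · intro a ha hak w hw h0
    have hp : parityVec w a ∈ Pv := (hPv _).2 ⟨a, w, ha, hak, fun i hi => G.deleteEdges_le _ (hw i hi),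
      h0, rfl⟩
    obtain ⟨i, hi, hne⟩ := Finset.exists_ne_zero_of_sum_ne_zero
      (show (∑ i ∈ Finset.range a, if s(w i, w (i + 1)) = e ⟨_, hp⟩ then (1 : ZMod 2) else 0) ≠ 0
        from he ⟨_, hp⟩)
    have h2 : s(w i, w (i + 1)) = e ⟨_, hp⟩ := by
      by_contra hcon
      exact hne (if_neg hcon)
    have h3 := (SimpleGraph.deleteEdges_adj.1 (hw i (Finset.mem_range.1 hi))).2
    rw [h2] at h3
    exact h3 (by simp [E])
  · have hcardE : E.card ≤ Pv.card := by
      refine Finset.card_image_le.trans ?_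
      simp
    have hcardPv : (Pv.card : ℝ) * τ ≤ Fintype.card W := by
      have hdisj : ∀ p ∈ (Finset.univ : Finset Pv), ∀ q ∈ (Finset.univ : Finset Pv), p ≠ q →
          Disjoint (G.neighborFinset (x p)) (G.neighborFinset (x q)) := by
        intro p _ q _ hpq
        rw [Finset.disjoint_left]
        intro z hz hz'
        obtain ⟨a, w, ⟨ha, hak, hw, hw0, hp⟩, hwx⟩ := hx p
        obtain ⟨b, w', ⟨hb, hbk, hw', hw0', hq⟩, hwx'⟩ := hx q
        apply hpq
        apply Subtype.ext
        rw [← hp, ← hq]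
        refine h.parityVec_eq ha hak hb hbk hw hw0 hw' hw0' (z := z) ?_ ?_
        · rw [hwx]; exact ((G.mem_neighborFinset _ _).1 hz).symm
        · rw [hwx']; exact ((G.mem_neighborFinset _ _).1 hz').symm
      have h1 := Finset.card_biUnion hdisj
      have h2 : ((∑ p : Pv, (G.neighborFinset (x p)).card : ℕ) : ℝ) ≤ Fintype.card W := by
        rw [← h1]
        exact_mod_cast Finset.card_le_univ _
      refine le_trans ?_ h2
      push_cast
      simp only [G.card_neighborFinset_eq_degree]
      have h3 : ∑ _p : Pv, τ ≤ ∑ p : Pv, (G.degree (x p) : ℝ) :=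
        Finset.sum_le_sum fun p _ => hdeg (x p)
      simpa using h3
    have h1 : G.edgeSet.ncard ≤ (G.deleteEdges (E : Set (Sym2 W))).edgeSet.ncard + E.card := by
      rw [SimpleGraph.edgeSet_deleteEdges, ← Set.ncard_coe_finset E]
      exact Set.ncard_le_ncard_sdiff_add_ncard _ _ (Set.toFinite _)
    have h2 : (E.card : ℝ) ≤ Fintype.card W / τ := by
      rw [le_div_iff₀ hτ]
      refine le_trans ?_ hcardPv
      exact mul_le_mul_of_nonneg_right (by exact_mod_cast hcardE) hτ.le
    have h3 : (G.edgeSet.ncard : ℝ) ≤ (G.deleteEdges (E : Set (Sym2 W))).edgeSet.ncard + E.card := by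
      exact_mod_cast h1
    linarith

/-- Every graph has an induced subgraph of minimum degree at least `τ` that is obtained by
removing at most `τ` edges per removed vertex. -/
theorem exists_induce_le_degree [Fintype W] (G : SimpleGraph W) (τ : ℝ) :
    ∃ A : Finset W, (G.edgeSet.ncard : ℝ) ≤
        (G.induce (A : Set W)).edgeSet.ncard + τ * (Fintype.card W - A.card) ∧
      ∀ v : (A : Set W), τ ≤ ((G.induce (A : Set W)).neighborSet v).ncard := by
  classical
  let c : Finset W → ℕ := fun A => {e ∈ G.edgeSet | ∀ x ∈ e, x ∈ A}.ncard
  have hc : ∀ A : Finset W, (G.induce (A : Set W)).edgeSet.ncard = c A := by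
    intro A
    rw [← Set.ncard_image_of_injective _ (Sym2.map.injective (Subtype.val_injective (p := (· ∈ (A : Set W)))))]
    congr 1
    ext e
    constructor
    · rintro ⟨f, hf, rfl⟩
      induction f with | _ u v
      refine ⟨hf, fun x hx => ?_⟩
      rw [Sym2.map_mk, Sym2.mem_iff] at hx
      rcases hx with rfl | rfl
      exacts [u.2, v.2]
    · rintro ⟨he, hA⟩
      induction e with | _ u v
      exact ⟨s(⟨u, hA u (by simp)⟩, ⟨v, hA v (by simp)⟩), he, rfl⟩
  obtain ⟨A, -, hA⟩ := Finset.exists_max_image (Finset.univ : Finset (Finset W))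
    (fun A => (c A : ℝ) - τ * A.card) Finset.univ_nonempty
  refine ⟨A, ?_, fun v => ?_⟩
  · have h1 := hA Finset.univ (Finset.mem_univ _)
    have h2 : c Finset.univ = G.edgeSet.ncard := by simp [c]
    rw [Finset.card_univ, h2] at h1
    rw [hc]
    linarith
  · by_contra hlt
    push Not at hlt
    have h1 := hA (A.erase v) (Finset.mem_univ _)
    have hvA : (v : W) ∈ A := v.2
    rw [Finset.card_erase_of_mem hvA, Nat.cast_sub (Finset.card_pos.2 ⟨_, hvA⟩), Nat.cast_one] at h1
    have h2 : c A ≤ c (A.erase v) + ((G.induce (A : Set W)).neighborSet v).ncard := by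
      rw [← Set.ncard_image_of_injective (f := fun y : (A : Set W) => s((v : W), (y : W))) _ ?_]
      · refine le_trans (Set.ncard_le_ncard ?_ (Set.toFinite _)) (Set.ncard_union_le _ _)
        rintro e ⟨he, heA⟩
        by_cases hv : (v : W) ∈ e
        · right
          obtain ⟨y, rfl⟩ := hv
          exact ⟨⟨y, heA y (by simp)⟩, he, rfl⟩
        · left
          exact ⟨he, fun x hx => Finset.mem_erase.2 ⟨fun h => hv (h ▸ hx), heA x hx⟩⟩
      · intro y y' hyy
        exact Subtype.ext (Sym2.congr_right.1 hyy)
    have h3 : (c A : ℝ) ≤ c (A.erase v) + ((G.induce (A : Set W)).neighborSet v).ncard := by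
      exact_mod_cast h2
    linarith

end

/-! ### The upper bound -/

/-- The average degree allowed by the Moore bound, up to an error that tends to zero: the product
`d * (d - 1) ^ (k - 1)` is compared with the power of the mean of its factors. -/
theorem le_of_moore_bound {k : ℕ} (hk : 2 ≤ k) {d T : ℝ} (hd : 2 ≤ d) (hT : 0 < T)
    (h : d * (d - 1) ^ (k - 1) ≤ T ^ k + ((k : ℝ) - 2) * d) :
    d ≤ T + ((k : ℝ) - 1) / k + 2 * k / T := by
  obtain ⟨j, rfl⟩ : ∃ j, k = j + 2 := ⟨k - 2, by omega⟩
  rw [show j + 2 - 1 = j + 1 by omega] at h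
  push_cast at h ⊢
  set κ : ℝ := (j : ℝ) + 2 with hκ
  have hj0 : (0 : ℝ) ≤ j := Nat.cast_nonneg j
  have hκ0 : 0 < κ := by positivity
  set c : ℝ := (κ - 1) / κ with hc
  have hc0 : 0 ≤ c := div_nonneg (by linarith) hκ0.le
  have hc1 : c ≤ 1 := by rw [hc, div_le_one hκ0]; linarith
  have hcκ : 1 - c = 1 / κ := by rw [hc]; field_simp; ring
  set s : ℝ := d - c with hs
  have hs1 : 1 ≤ s := by linarith
  have hs0 : 0 < s := by linarith
  have hsj : 0 < s ^ j := pow_pos hs0 j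
  have hbern : s ^ j * (s - c) ≤ (d - 1) ^ (j + 1) := by
    have h1 := one_add_mul_le_pow (a := -(1 / κ / s)) (n := j + 1) (by
      have : 1 / κ / s ≤ 1 := by
        rw [div_div, div_le_one (by positivity)]
        nlinarith
      linarith)
    have h2 : s * (1 + -(1 / κ / s)) = d - 1 := by
      rw [mul_add, mul_neg, mul_div_cancel₀ _ hs0.ne', ← hcκ]; ring
    have h3 : s * (1 + ((j + 1 : ℕ) : ℝ) * -(1 / κ / s)) = s - c := by
      push_cast
      rw [hc, hκ]; field_simp; ring
    rw [← h2, mul_pow, ← h3, ← mul_assoc, ← pow_succ]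
    exact mul_le_mul_of_nonneg_left h1 (by positivity)
  have hlow : s ^ j * (s ^ 2 - 1) ≤ d * (d - 1) ^ (j + 1) := by
    have h1 : d * (s ^ j * (s - c)) ≤ d * (d - 1) ^ (j + 1) :=
      mul_le_mul_of_nonneg_left hbern (by linarith)
    refine le_trans ?_ h1
    rw [show d * (s ^ j * (s - c)) = s ^ j * (s ^ 2 - c ^ 2) by rw [hs]; ring]
    refine mul_le_mul_of_nonneg_left ?_ hsj.le
    nlinarith
  have herr : (κ - 2) * d ≤ 2 * j * s ^ j := by
    rcases Nat.eq_zero_or_pos j with h0 | h0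
    · simp [hκ, h0]
    · have h1 : s ≤ s ^ j := le_self_pow₀ hs1 h0.ne'
      have h2 : d ≤ 2 * s ^ j := by linarith
      rw [show κ - 2 = (j : ℝ) by rw [hκ]; ring]
      nlinarith
  have hmain : s ^ (j + 2) - T ^ (j + 2) ≤ (1 + 2 * j) * s ^ j := by
    have : s ^ (j + 2) = s ^ j * s ^ 2 := pow_add _ _ _
    nlinarith
  have hgoal : s ≤ T + (1 + 2 * j) / T := by
    rcases le_or_gt s T with h1 | h1
    · have : 0 ≤ (1 + 2 * (j : ℝ)) / T := by positivity
      linarith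
    · have h2 : T ^ (j + 2) ≤ T * (s * s ^ j) := by
        rw [← pow_succ', show j + 2 = j + 1 + 1 by rfl, pow_succ' T (j + 1)]
        exact mul_le_mul_of_nonneg_left (pow_le_pow_left₀ hT.le h1.le _) hT.le
      have h3 : s ^ j * ((s - T) * s) ≤ s ^ j * (1 + 2 * j) := by
        have : s ^ (j + 2) = s ^ j * s ^ 2 := pow_add _ _ _
        nlinarith
      have h4 : (s - T) * s ≤ 1 + 2 * j := le_of_mul_le_mul_left h3 hsj
      have h5 : (s - T) * T ≤ 1 + 2 * j := by nlinarith
      have h6 := (le_div_iff₀ hT).2 h5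
      linarith
  have hfin : (1 + 2 * (j : ℝ)) / T ≤ 2 * κ / T := by
    gcongr
    rw [hκ]; linarith
  linarith

theorem two_mul_ncard_edgeSet {W : Type*} [Fintype W] [DecidableEq W] (G : SimpleGraph W)
    [DecidableRel G.Adj] : ∑ v, G.degree v = 2 * G.edgeSet.ncard := by
  rw [G.sum_degrees_eq_twice_card_edges, Set.ncard_eq_toFinset_card', SimpleGraph.edgeFinset]

theorem IsBalanced.two_mul_ncard_edgeSet_le {W : Type*} [Fintype W] [DecidableEq W] [Nonempty W]
    {G : SimpleGraph W} [DecidableRel G.Adj] {k : ℕ} (hk : 2 ≤ k) (h : IsBalanced G k)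
    (hodd : NoShortOddWalk G k) (hdeg : ∀ v, 2 ≤ G.degree v) {T : ℝ} (hT : 0 < T)
    (hTk : T ^ k = Fintype.card W) :
    2 * (G.edgeSet.ncard : ℝ) ≤
      Fintype.card W * T + (k - 1) / k * Fintype.card W + 2 * k * T ^ (k - 1) := by
  have hn : (0 : ℝ) < Fintype.card W := by exact_mod_cast Fintype.card_pos
  set d : ℝ := (∑ v, (G.degree v : ℝ)) / Fintype.card W with hd
  have hdn : d * Fintype.card W = ∑ v, (G.degree v : ℝ) := div_mul_cancel₀ _ hn.ne'
  obtain ⟨h2, h3⟩ := (h.almostNoShortEvenWalk hodd).moore_bound hk hdeg d hdn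
  rw [← hTk] at h3
  have h4 := mul_le_mul_of_nonneg_right (le_of_moore_bound hk h2 hT h3) hn.le
  have h5 : ∑ v, (G.degree v : ℝ) = 2 * (G.edgeSet.ncard : ℝ) := by
    exact_mod_cast two_mul_ncard_edgeSet G
  rw [hdn, h5] at h4
  have h6 : 2 * k / T * (Fintype.card W : ℝ) = 2 * k * T ^ (k - 1) := by
    rw [← hTk, show T ^ k = T ^ (k - 1) * T by rw [← pow_succ]; congr 1; omega]
    field_simp
  nlinarith

theorem degree_eq_ncard {W : Type*} [Fintype W] (G : SimpleGraph W) [DecidableRel G.Adj] (v : W) :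
    G.degree v = (G.neighborSet v).ncard := by
  rw [← G.card_neighborSet_eq_degree, Set.ncard_eq_toFinset_card', Set.toFinset_card]

/-- Vertices of degree less than `t / 2`, where `t = n ^ (1 / k)`, can be discarded because the
bound grows faster than that with `n`. This is done once before and once after short odd closed
walks are destroyed. -/
theorem IsBalanced.ncard_edgeSet_le {W : Type*} [Fintype W] [DecidableEq W]
    {G : SimpleGraph W} {k : ℕ} (hk : 2 ≤ k) (h : IsBalanced G k) {t : ℝ} (ht : 6 ≤ t)
    (htk : t ^ k = Fintype.card W) :
    (G.edgeSet.ncard : ℝ) ≤ 1 / 2 * (Fintype.card W * t) +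
      ((k : ℝ) - 1) / (2 * k) * Fintype.card W + (k + 2) / t * Fintype.card W := by
  classical
  set n : ℝ := (Fintype.card W : ℝ) with hn
  have ht0 : 0 < t := by linarith
  have hk2 : (2 : ℝ) ≤ k := by exact_mod_cast hk
  obtain ⟨A, hA, hAdeg⟩ := exists_induce_le_degree G (t / 2)
  set H := G.induce (A : Set W) with hH
  have hcardA : Fintype.card (A : Set W) = A.card := by simp
  obtain ⟨H', hH', hodd, hHe⟩ := (h.induce (A : Set W)).exists_noShortOddWalk (τ := t / 2)
    (by linarith) (fun v => by rw [degree_eq_ncard]; exact hAdeg v)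
  obtain ⟨B, hB, hBdeg⟩ := exists_induce_le_degree H' (t / 2)
  set H'' := H'.induce (B : Set (A : Set W)) with hH''
  have hcardB : Fintype.card (B : Set (A : Set W)) = B.card := by simp
  have hbal : IsBalanced H'' k := ((h.induce _).mono hH').induce _
  have hodd' : NoShortOddWalk H'' k := hodd.induce _
  rw [hcardA] at hHe hB
  have hAn : (A.card : ℝ) ≤ n := by rw [hn]; exact_mod_cast Finset.card_le_univ A
  have hBA : (B.card : ℝ) ≤ A.card := by
    rw [← hcardA]; exact_mod_cast Finset.card_le_univ B
  have hnt : t ^ (k - 1) = n / t := by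
    rw [eq_div_iff ht0.ne', ← pow_succ, ← htk]; congr 1; omega
  have hlast : 2 * (H''.edgeSet.ncard : ℝ) ≤ B.card * t + (k - 1) / k * n + 2 * k * (n / t) := by
    have hc0 : 0 ≤ ((k : ℝ) - 1) / k := div_nonneg (by linarith) (by linarith)
    have hn0 : 0 ≤ n := by rw [hn]; positivity
    rcases isEmpty_or_nonempty (B : Set (A : Set W)) with he | he
    · have h0 : H''.edgeSet = ∅ := by
        rw [Set.eq_empty_iff_forall_notMem]
        intro e
        induction e with | _ u v
        exact he.elim u
      rw [h0, Set.ncard_empty, Nat.cast_zero, mul_zero]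
      positivity
    · have hN : (0 : ℝ) < B.card := by
        rw [← hcardB]; exact_mod_cast Fintype.card_pos
      set T : ℝ := (B.card : ℝ) ^ ((k : ℝ)⁻¹) with hT
      have hT0 : 0 < T := Real.rpow_pos_of_pos hN _
      have hTk : T ^ k = B.card := Real.rpow_inv_natCast_pow hN.le (by omega)
      have hTt : T ≤ t := by
        refine le_of_pow_le_pow_left₀ (n := k) (by omega) ht0.le ?_
        rw [hTk, htk]; linarith
      have h1 := hbal.two_mul_ncard_edgeSet_le hk hodd' (fun v => by
        have h2 := hBdeg v
        rw [← degree_eq_ncard] at h2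
        have h3 : (2 : ℝ) ≤ (H''.degree v : ℝ) := by linarith
        exact_mod_cast h3) hT0 (by rw [hTk, hcardB])
      rw [hcardB] at h1
      have h4 : T ^ (k - 1) ≤ n / t := by
        rw [← hnt]; exact pow_le_pow_left₀ hT0.le hTt _
      have h5 : (B.card : ℝ) * T ≤ B.card * t := mul_le_mul_of_nonneg_left hTt hN.le
      have h6 : ((k : ℝ) - 1) / k * B.card ≤ (k - 1) / k * n :=
        mul_le_mul_of_nonneg_left (by linarith) hc0
      have h7 : 2 * (k : ℝ) * T ^ (k - 1) ≤ 2 * k * (n / t) :=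
        mul_le_mul_of_nonneg_left h4 (by linarith)
      linarith
  have h1 : (A.card : ℝ) / (t / 2) ≤ 2 * (n / t) := by
    rw [div_le_iff₀ (by linarith), mul_assoc, div_mul_div_comm, mul_comm t 2,
      mul_div_mul_right _ _ ht0.ne']
    linarith
  have h2 : ((k : ℝ) - 1) / (2 * k) * n = (k - 1) / k * n / 2 := by
    field_simp
  have h3 : ((k : ℝ) + 2) / t * n = k * (n / t) + 2 * (n / t) := by
    field_simp
  rw [h2, h3]
  linarith

/-- The error term is `ε n = C / n ^ (1 / k)` with a constant `C` large enough to make the bound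
trivial when `n ^ (1 / k) < 6`. -/
theorem exists_upper_bound (k : ℕ) (hk : 2 ≤ k) :
    ∃ ε : ℕ → ℝ, Tendsto ε atTop (𝓝 0) ∧
      ∀ (n : ℕ) (G : SimpleGraph (Fin n)), IsNeighborly k (edgePolytope G) →
        ((polytopeVertices (edgePolytope G)).ncard : ℝ) ≤
          1 / 2 * (n : ℝ) ^ (1 + 1 / (k : ℝ)) +
            (((k : ℝ) - 1) / (2 * (k : ℝ)) + ε n) * (n : ℝ) := by
  have hk2 : (2 : ℝ) ≤ k := by exact_mod_cast hk
  have hk0 : (0 : ℝ) < 1 / k := by positivity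
  set C : ℝ := (k + 2) + 6 * 6 ^ k with hC
  have hCpos : 0 < C := by positivity
  refine ⟨fun n => C / (n : ℝ) ^ (1 / (k : ℝ)), ?_, ?_⟩
  · exact ((tendsto_rpow_atTop hk0).comp tendsto_natCast_atTop_atTop).const_div_atTop C
  intro n G hG
  rw [ncard_polytopeVertices]
  rcases Nat.eq_zero_or_pos n with rfl | hn
  · have h0 : G.edgeSet = ∅ := by
      rw [Set.eq_empty_iff_forall_notMem]
      intro e
      induction e with | _ u v
      exact u.elim0
    rw [h0, Set.ncard_empty, Nat.cast_zero, mul_zero, add_zero]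
    positivity
  have hn0 : (0 : ℝ) < n := by exact_mod_cast hn
  set t : ℝ := (n : ℝ) ^ (1 / (k : ℝ)) with ht
  have ht0 : 0 < t := Real.rpow_pos_of_pos hn0 _
  have htk : t ^ k = n := by
    rw [ht, one_div]; exact Real.rpow_inv_natCast_pow hn0.le (by omega)
  have hpow : (n : ℝ) ^ (1 + 1 / (k : ℝ)) = n * t := by
    rw [Real.rpow_add hn0, Real.rpow_one]
  rw [hpow, add_mul, ← add_assoc]
  have hc0 : 0 ≤ ((k : ℝ) - 1) / (2 * k) := div_nonneg (by linarith) (by linarith)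
  rcases le_or_gt 6 t with h6 | h6
  · have h1 := (hG.isBalanced).ncard_edgeSet_le hk h6 (by rw [htk, Fintype.card_fin])
    rw [Fintype.card_fin] at h1
    have h2 : (k + 2) / t * n ≤ C / t * n := by
      gcongr
      rw [hC]
      have : (0 : ℝ) < 6 * 6 ^ k := by positivity
      linarith
    linarith
  · classical
    have h1 : (G.edgeSet.ncard : ℝ) ≤ n * n := by
      have h3 := two_mul_ncard_edgeSet G
      have h4 : ∑ v, G.degree v ≤ ∑ _v : Fin n, n := Finset.sum_le_sum fun v _ => by
        have := G.degree_lt_card_verts v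
        rw [Fintype.card_fin] at this
        exact this.le
      rw [Finset.sum_const, Finset.card_univ, Fintype.card_fin, smul_eq_mul] at h4
      have h5 : G.edgeSet.ncard ≤ n * n := by omega
      exact_mod_cast h5
    have h2 : (n : ℝ) ≤ C / t := by
      rw [le_div_iff₀ ht0]
      have h3 : (n : ℝ) ≤ 6 ^ k := by
        rw [← htk]; exact pow_le_pow_left₀ ht0.le h6.le k
      have h4 : (n : ℝ) * t ≤ 6 ^ k * 6 := mul_le_mul h3 h6.le ht0.le (by positivity)
      rw [hC]
      linarith
    have h3 : (n : ℝ) * n ≤ C / t * n := mul_le_mul_of_nonneg_right h2 hn0.le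
    have h4 : 0 ≤ 1 / 2 * (n * t) := by positivity
    have h5 : 0 ≤ ((k : ℝ) - 1) / (2 * k) * n := mul_nonneg hc0 hn0.le
    linarith

/-! ### Graphs attaining the bound: general facts -/

/-- It suffices to exclude closed walks that do not backtrack at the base point either. -/
theorem noShortEvenWalk_of_cyclic {V : Type*} {G : SimpleGraph V} {k : ℕ}
    (h : ∀ m, 2 ≤ m → m ≤ k → ∀ w, IsNBWalk G (2 * m) w → w 0 = w (2 * m) →
      w 1 ≠ w (2 * m - 1) → False) : NoShortEvenWalk G k := by
  intro m hm
  induction m, hm using Nat.le_induction with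
  | base => exact fun _ w hw => hw.ne 0 (by omega)
  | succ m hm ih =>
    intro hmk w hw h0
    refine h (m + 1) (by omega) hmk w hw h0 fun h1 => ?_
    refine ih (by omega) _ (hw.shift 1 (2 * m) (by omega)) ?_
    simp only [add_zero]
    rw [h1]; congr 1; omega

/-- The graph whose vertices are the pairs `(t, w)` and the points `t`, in which `t` is adjacent
to all pairs `(t, w)`, and pairs are adjacent when they are related by `R`. -/
def fiberGraph {T F : Type*} (R : T × F → T × F → Prop) (hR : ∀ v v', R v v' → R v' v) :
    SimpleGraph ((T × F) ⊕ T) where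
  Adj p q := match p, q with
    | .inl v, .inl v' => R v v' ∧ v ≠ v'
    | .inl v, .inr t => v.1 = t
    | .inr t, .inl v => v.1 = t
    | .inr _, .inr _ => False
  symm := ⟨by
    rintro (v | t) (v' | t') h
    · exact ⟨hR _ _ h.1, h.2.symm⟩
    · exact h
    · exact h
    · exact h⟩
  loopless := ⟨by
    rintro (v | t) h
    · exact h.2 rfl
    · exact h⟩

section
variable {T F : Type*} {R : T × F → T × F → Prop} {hR : ∀ v v', R v v' → R v' v}

theorem fiberGraph_not_isIsolated [Nonempty F] (p : (T × F) ⊕ T) :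
    ¬ (fiberGraph R hR).IsIsolated p := by
  intro h
  rcases p with v | t
  · exact h (.inr v.1) rfl
  · exact h (.inl (t, Classical.arbitrary F)) rfl

/-- Each pair has one `R`-related pair for every value of the coordinate `ξ`, at most one of which
is the pair itself; in every fiber only one pair is related to itself. -/
theorem le_two_mul_ncard_edgeSet_fiberGraph [Fintype T] [Fintype F] (ξ : T → F)
    (nb : T × F → F → T × F) (hnb : ∀ v x, R v (nb v x)) (hξ : ∀ v x, ξ (nb v x).1 = x)
    (hloop : ∀ v v', R v v → R v' v' → v.1 = v'.1 → v = v') :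
    Fintype.card T * Fintype.card F ^ 2 + 2 * (Fintype.card T * Fintype.card F) ≤
      2 * (fiberGraph R hR).edgeSet.ncard + Fintype.card T := by
  classical
  have h1 : ∀ v : T × F, Fintype.card F + 1 ≤
      (fiberGraph R hR).degree (.inl v) + if R v v then 1 else 0 := by
    intro v
    have hinj : Function.Injective fun x => (Sum.inl (nb v x) : (T × F) ⊕ T) := by
      intro x y hxy
      have h2 : nb v x = nb v y := Sum.inl_injective hxy
      rw [← hξ v x, h2, hξ]
    let S : Finset ((T × F) ⊕ T) := Finset.univ.image fun x => Sum.inl (nb v x)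
    have hS : S.card = Fintype.card F := Finset.card_image_of_injective _ hinj
    have hsub : insert (Sum.inr v.1) (S.erase (Sum.inl v)) ⊆
        (fiberGraph R hR).neighborFinset (.inl v) := by
      intro p hp
      rw [SimpleGraph.mem_neighborFinset]
      rcases Finset.mem_insert.1 hp with rfl | hp
      · rfl
      · obtain ⟨hne, hp⟩ := Finset.mem_erase.1 hp
        obtain ⟨x, -, rfl⟩ := Finset.mem_image.1 hp
        exact ⟨hnb v x, fun h => hne (congrArg Sum.inl h.symm)⟩
    have hcard := Finset.card_le_card hsub
    rw [SimpleGraph.card_neighborFinset_eq_degree, Finset.card_insert_of_notMem (by simp [S])]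
      at hcard
    split_ifs with hv
    · have := Finset.pred_card_le_card_erase (s := S) (a := Sum.inl v)
      omega
    · rw [Finset.erase_eq_of_notMem] at hcard
      · omega
      · intro hp
        obtain ⟨x, -, hx⟩ := Finset.mem_image.1 hp
        have h2 : nb v x = v := Sum.inl_injective hx
        have h3 := hnb v x
        rw [h2] at h3
        exact hv h3
  have h2 : ∀ t : T, Fintype.card F ≤ (fiberGraph R hR).degree (.inr t) := by
    intro t
    have hinj : Function.Injective fun x : F => (Sum.inl (t, x) : (T × F) ⊕ T) := by
      intro x y hxy
      simpa using hxy
    rw [← SimpleGraph.card_neighborFinset_eq_degree, ← Finset.card_univ,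
      ← Finset.card_image_of_injective _ hinj]
    refine Finset.card_le_card fun p hp => ?_
    obtain ⟨x, -, rfl⟩ := Finset.mem_image.1 hp
    rw [SimpleGraph.mem_neighborFinset]
    rfl
  have h3 : (∑ v : T × F, if R v v then 1 else 0) ≤ Fintype.card T := by
    rw [← Finset.card_filter, ← Finset.card_univ]
    refine Finset.card_le_card_of_injOn Prod.fst (fun _ _ => by simp) ?_
    intro v hv v' hv' h
    exact hloop v v' (by simpa using hv) (by simpa using hv') h
  have h4 := two_mul_ncard_edgeSet (fiberGraph R hR)
  rw [Fintype.sum_sum_type] at h4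
  have h5 := Finset.sum_le_sum fun v (_ : v ∈ Finset.univ) => h1 v
  have h6 := Finset.sum_le_sum fun t (_ : t ∈ Finset.univ) => h2 t
  rw [Finset.sum_const, Finset.card_univ, Fintype.card_prod, smul_eq_mul,
    Finset.sum_add_distrib] at h5
  rw [Finset.sum_const, Finset.card_univ, smul_eq_mul] at h6
  nlinarith

end

/-- The arithmetic of the lower bound. Bernoulli's inequality gives `n ^ (1 / k) ≤ q + 1 / k`. -/
theorem lower_bound_arith {k q n : ℕ} (hk : 2 ≤ k) (hq : 1 ≤ q) (hn : n = q ^ k + q ^ (k - 1))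
    {e : ℝ} (he : (q : ℝ) ^ (k + 1) + 2 * q ^ k ≤ 2 * e + q ^ (k - 1)) :
    1 / 2 * (n : ℝ) ^ (1 + 1 / (k : ℝ)) + ((k : ℝ) - 1) / (2 * (k : ℝ)) * (n : ℝ)
      - (n : ℝ) ^ (1 - 1 / (k : ℝ)) ≤ e := by
  obtain ⟨j, rfl⟩ : ∃ j, k = j + 1 := ⟨k - 1, by omega⟩
  rw [Nat.add_sub_cancel] at hn he
  set κ : ℝ := ((j + 1 : ℕ) : ℝ) with hκ
  have hκ2 : 2 ≤ κ := by rw [hκ]; exact_mod_cast hk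
  have hκ0 : 0 < κ := by linarith
  have hq1 : (1 : ℝ) ≤ q := by exact_mod_cast hq
  have hq0 : (0 : ℝ) < q := by linarith
  have hqj : (0 : ℝ) < (q : ℝ) ^ j := pow_pos hq0 j
  have hnr : (n : ℝ) = q ^ (j + 1) + q ^ j := by rw [hn]; push_cast; rfl
  have hn0 : (0 : ℝ) < n := by rw [hnr]; positivity
  have h1 : (n : ℝ) ^ (1 / κ) ≤ q + 1 / κ := by
    have hb := one_add_mul_le_pow (a := 1 / (κ * q)) (n := j + 1)
      (by have : 0 ≤ 1 / (κ * (q : ℝ)) := by positivity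
          linarith)
    have h2 : (n : ℝ) ≤ (q + 1 / κ) ^ (j + 1) := by
      have h3 : (q : ℝ) + 1 / κ = q * (1 + 1 / (κ * q)) := by field_simp
      rw [h3, mul_pow, hnr]
      refine le_trans (le_of_eq ?_) (mul_le_mul_of_nonneg_left hb (by positivity))
      rw [← hκ]; field_simp; ring
    calc (n : ℝ) ^ (1 / κ) ≤ ((q + 1 / κ) ^ (j + 1)) ^ (1 / κ) :=
          Real.rpow_le_rpow hn0.le h2 (by positivity)
      _ = q + 1 / κ := by
          rw [one_div κ, hκ]
          exact Real.pow_rpow_inv_natCast (by positivity) (by omega)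
  have h2 : (q : ℝ) ^ j ≤ (n : ℝ) ^ (1 - 1 / κ) := by
    have h3 : ((q : ℝ) ^ (j + 1)) ^ (1 - 1 / κ) = q ^ j := by
      rw [← Real.rpow_natCast, ← Real.rpow_mul hq0.le, ← Real.rpow_natCast]
      congr 1
      rw [← hκ, mul_sub, mul_one, mul_one_div, div_self hκ0.ne', hκ]
      push_cast; ring
    rw [← h3]
    refine Real.rpow_le_rpow (by positivity) ?_ ?_
    · rw [hnr]; linarith
    · rw [sub_nonneg, div_le_one hκ0]; linarith
  rw [Real.rpow_add hn0, Real.rpow_one]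
  have h3 : (n : ℝ) * (n : ℝ) ^ (1 / κ) ≤ n * (q + 1 / κ) := mul_le_mul_of_nonneg_left h1 hn0.le
  have h4 : (κ - 1) / (2 * κ) * (n : ℝ) = n / 2 - n * (1 / κ) / 2 := by
    field_simp
  have h5 : (n : ℝ) * q = q ^ (j + 1 + 1) + q ^ (j + 1) := by rw [hnr]; ring
  rw [h4]
  nlinarith

/-- Transport to the vertex set `Fin n` of a family of graphs that have the required size. -/
theorem infinite_of_family {k : ℕ} (hk : 2 ≤ k) (h : ∀ N : ℕ, ∃ q > N, ∃ (V : Type)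
      (_ : Fintype V) (G : SimpleGraph V), Fintype.card V = q ^ k + q ^ (k - 1) ∧
      NoShortEvenWalk G k ∧ (∀ v, ¬ G.IsIsolated v) ∧
      q ^ (k + 1) + 2 * q ^ k ≤ 2 * G.edgeSet.ncard + q ^ (k - 1)) :
    {n : ℕ | ∃ G : SimpleGraph (Fin n), (∀ v, ¬ G.IsIsolated v) ∧
        IsNeighborly k (edgePolytope G) ∧
        1 / 2 * (n : ℝ) ^ (1 + 1 / (k : ℝ)) + ((k : ℝ) - 1) / (2 * (k : ℝ)) * (n : ℝ)
            - (n : ℝ) ^ (1 - 1 / (k : ℝ)) ≤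
          ((polytopeVertices (edgePolytope G)).ncard : ℝ)}.Infinite := by
  refine Set.infinite_of_forall_exists_gt fun N => ?_
  obtain ⟨q, hq, V, _, G, hV, hG, hiso, he⟩ := h N
  let f : Fin (Fintype.card V) ≃ V := (Fintype.equivFin V).symm
  let G' := G.comap f
  refine ⟨Fintype.card V, ⟨G', ?_, ?_, ?_⟩, ?_⟩
  · intro v hv
    refine hiso (f v) fun y hy => hv (f.symm y) ?_
    show G.Adj (f v) (f (f.symm y))
    rwa [f.apply_symm_apply]
  · refine NoShortEvenWalk.isNeighborly fun m hm hmk w hw h0 => ?_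
    exact hG m hm hmk (fun i => f (w i)) ⟨fun i hi => hw.adj i hi,
      fun i hi heq => hw.ne i hi (f.injective heq)⟩ (congrArg f h0)
  · rw [ncard_polytopeVertices]
    have h1 : G'.edgeSet.ncard = G.edgeSet.ncard :=
      Nat.card_congr (SimpleGraph.Iso.comap f G).mapEdgeSet
    rw [h1]
    exact lower_bound_arith hk (by omega) hV (by exact_mod_cast he)
  · rw [hV]
    calc N < q := hq
      _ ≤ q ^ k := Nat.le_self_pow (by omega) q
      _ ≤ _ := Nat.le_add_right _ _

/-! ### The plane: `k = 2` -/

section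
variable {F : Type*} [Field F]

/-- Two points of the affine plane whose coordinates satisfy `y + y' = x x'`. -/
def planeRel (v v' : F × F) : Prop := v.2 + v'.2 = v.1 * v'.1

theorem planeRel_symm (v v' : F × F) (h : planeRel v v') : planeRel v' v := by
  unfold planeRel at *
  rw [add_comm, h, mul_comm]

theorem plane_noShortEvenWalk : NoShortEvenWalk (fiberGraph (planeRel (F := F)) planeRel_symm) 2 := by
  refine noShortEvenWalk_of_cyclic fun m hm hm2 w hw h0 h1 => ?_
  obtain rfl : m = 2 := by omega
  have key : ∀ p q u u' : (F × F) ⊕ F, (fiberGraph (planeRel (F := F)) planeRel_symm).Adj p u →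
      (fiberGraph (planeRel (F := F)) planeRel_symm).Adj u q →
      (fiberGraph (planeRel (F := F)) planeRel_symm).Adj q u' →
      (fiberGraph (planeRel (F := F)) planeRel_symm).Adj u' p → p ≠ q → u ≠ u' → False := by
    rintro (⟨x, y⟩ | t) (⟨x', y'⟩ | t') (⟨z, r⟩ | s) (⟨z', r'⟩ | s') <;>
      simp only [fiberGraph, planeRel, ne_eq, Sum.inl.injEq, Sum.inr.injEq, Prod.mk.injEq,
        reduceCtorEq, not_false_eq_true] <;> grind
  refine key (w 0) (w 2) (w 1) (w 3) (hw.adj 0 (by omega)) (hw.adj 1 (by omega))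
    (hw.adj 2 (by omega)) ?_ (hw.ne 0 (by omega)) h1
  rw [h0]; exact hw.adj 3 (by omega)

end

theorem infinite_two :
    {n : ℕ | ∃ G : SimpleGraph (Fin n), (∀ v, ¬ G.IsIsolated v) ∧
        IsNeighborly 2 (edgePolytope G) ∧
        1 / 2 * (n : ℝ) ^ (1 + 1 / ((2 : ℕ) : ℝ)) +
            (((2 : ℕ) : ℝ) - 1) / (2 * ((2 : ℕ) : ℝ)) * (n : ℝ)
            - (n : ℝ) ^ (1 - 1 / ((2 : ℕ) : ℝ)) ≤
          ((polytopeVertices (edgePolytope G)).ncard : ℝ)}.Infinite := by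
  refine infinite_of_family le_rfl fun N => ?_
  obtain ⟨p, hpN, hp⟩ := Nat.exists_infinite_primes (N + 3)
  have : Fact p.Prime := ⟨hp⟩
  have h2 : (2 : ZMod p) ≠ 0 := by
    intro h
    have h3 : ((2 : ℕ) : ZMod p) = 0 := by exact_mod_cast h
    rw [ZMod.natCast_eq_zero_iff] at h3
    have := Nat.le_of_dvd (by norm_num) h3
    omega
  refine ⟨p, by omega, (ZMod p × ZMod p) ⊕ ZMod p, inferInstance,
    fiberGraph planeRel planeRel_symm, ?_, plane_noShortEvenWalk, fiberGraph_not_isIsolated, ?_⟩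
  · simp [ZMod.card]; ring
  · have := le_two_mul_ncard_edgeSet_fiberGraph (R := planeRel) (hR := planeRel_symm (F := ZMod p)) id
      (fun v x => (x, v.1 * x - v.2)) (fun v x => by simp [planeRel]) (fun v x => rfl) ?_
    · simp only [ZMod.card] at this
      simp only [Nat.reduceAdd, Nat.reduceSub, pow_one]
      nlinarith
    · rintro ⟨x, y⟩ ⟨x', y'⟩ h h' rfl
      simp only [planeRel] at h h'
      have : 2 * y = 2 * y' := by linear_combination h - h'
      rw [mul_left_cancel₀ h2 this]

/-! ### The generalized quadrangle: `k = 3` -/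

/-- In characteristic `p`, the field with `p ^ (2e+1)` elements has an endomorphism whose square is
the Frobenius map. -/
theorem exists_field_sqrt_frobenius (p : ℕ) [Fact p.Prime] (N : ℕ) :
    ∃ q > N, ∃ (F : Type) (_ : Field F) (_ : Fintype F) (_ : CharP F p) (σ : F →+* F),
      Fintype.card F = q ∧ ∀ x, σ (σ x) = x ^ p := by
  have hp := (Fact.out : p.Prime)
  let F := GaloisField p (2 * N + 1)
  have : Fintype F := Fintype.ofFinite F
  have hcard : Fintype.card F = p ^ (2 * N + 1) := by
    rw [Fintype.card_eq_nat_card]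
    exact GaloisField.card p (2 * N + 1) (by omega)
  refine ⟨p ^ (2 * N + 1), ?_, F, inferInstance, inferInstance, inferInstance,
    iterateFrobenius F p (N + 1), hcard, fun x => ?_⟩
  · calc N < 2 * N + 1 := by omega
      _ < p ^ (2 * N + 1) := Nat.lt_pow_self hp.one_lt
  · rw [iterateFrobenius_def, iterateFrobenius_def, ← pow_mul, ← pow_add,
      show N + 1 + (N + 1) = 2 * N + 1 + 1 by ring, pow_succ, pow_mul, ← hcard,
      FiniteField.pow_card]

section
variable {F : Type*} [Field F]

/-- Coordinates of points, and likewise of lines, of the symplectic quadrangle. Triples stand for the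
elements in general position with respect to a fixed flag. A pair stands for the line (point) that
is incident with all triples of points (lines) beginning with that pair. The few remaining elements
are left out. -/
abbrev QuadElt (F : Type*) := (F × F × F) ⊕ (F × F)

/-- Incidence of a point and a line of the symplectic quadrangle in characteristic two. -/
def QuadInc : QuadElt F → QuadElt F → Prop
  | .inl (a, l, a'), .inl (k, b, k') => b = a * k + a' ∧ k' = a ^ 2 * k + l
  | .inl (a, l, _), .inr t => (a, l) = t
  | .inr t, .inl (k, b, _) => (k, b) = t
  | .inr _, .inr _ => False

/-- The symplectic form on points, which vanishes exactly on collinear points. -/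
def quadForm : QuadElt F → QuadElt F → F
  | .inl (a, l, a'), .inl (c, m, c') => l + m + (a + c) * (a' + c')
  | .inl (a, _, a'), .inr (k, b) => b + a * k + a'
  | .inr (k, b), .inl (a, _, a') => b + a * k + a'
  | .inr (k, _), .inr (k', _) => k + k'

theorem quadForm_eq_zero [CharP F 2] (p q u : QuadElt F) (h : QuadInc p u) (h' : QuadInc q u) :
    quadForm p q = 0 := by
  rcases p with ⟨a, l, a'⟩ | ⟨k, b⟩ <;> rcases q with ⟨c, m, c'⟩ | ⟨k', b'⟩ <;>
    rcases u with ⟨x, y, z⟩ | ⟨x, y⟩ <;>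
    simp only [QuadInc, quadForm, Prod.mk.injEq] at h h' ⊢ <;> grind

theorem quadForm_ne_zero [CharP F 2] (p q r u u' : QuadElt F) (h1 : QuadInc p u)
    (h2 : QuadInc q u) (h3 : QuadInc q u') (h4 : QuadInc r u') (hpq : p ≠ q) (huu : u ≠ u')
    (hqr : q ≠ r) : quadForm p r ≠ 0 := by
  rcases p with ⟨a, l, a'⟩ | ⟨k, b⟩ <;> rcases q with ⟨c, m, c'⟩ | ⟨k', b'⟩ <;>
    rcases r with ⟨d, n, d'⟩ | ⟨f, g⟩ <;>
    rcases u with ⟨x, y, z⟩ | ⟨x, y⟩ <;> rcases u' with ⟨x', y', z'⟩ | ⟨x', y'⟩ <;>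
    simp only [QuadInc, quadForm, Prod.mk.injEq, ne_eq, Sum.inl.injEq, Sum.inr.injEq, reduceCtorEq,
      not_false_eq_true] at * <;> intro hz <;> grind

/-- Adjacency of the affine points of the polarity graph of the symplectic quadrangle. -/
def quadRel (σ : F →+* F) (v v' : (F × F) × F) : Prop :=
  v'.1.2 + v.2 = v.1.1 * σ v'.1.1 ∧ v.1.2 + v'.2 = v'.1.1 * σ v.1.1

theorem quadRel_symm (σ : F →+* F) (v v' : (F × F) × F) (h : quadRel σ v v') : quadRel σ v' v :=
  ⟨h.2, h.1⟩

/-- The vertices of the polarity graph as points of the quadrangle. -/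
def quadPoint (σ : F →+* F) : ((F × F) × F) ⊕ (F × F) → QuadElt F
  | .inl ((x, y), z) => .inl (x, σ y, z)
  | .inr (x, y) => .inr (σ x, y)

/-- The image under the polarity: the vertices of the polarity graph as lines. -/
def quadLine (σ : F →+* F) : ((F × F) × F) ⊕ (F × F) → QuadElt F
  | .inl ((x, y), z) => .inl (σ x, y, σ z)
  | .inr (x, y) => .inr (x, σ y)

theorem quadPoint_injective (σ : F →+* F) : Function.Injective (quadPoint σ) := by
  rintro (⟨⟨x, y⟩, z⟩ | ⟨x, y⟩) (⟨⟨x', y'⟩, z'⟩ | ⟨x', y'⟩) h <;>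
    simp_all [quadPoint, σ.injective.eq_iff]

theorem quadLine_injective (σ : F →+* F) : Function.Injective (quadLine σ) := by
  rintro (⟨⟨x, y⟩, z⟩ | ⟨x, y⟩) (⟨⟨x', y'⟩, z'⟩ | ⟨x', y'⟩) h <;>
    simp_all [quadLine, σ.injective.eq_iff]

theorem quadInc_of_adj [CharP F 2] (σ : F →+* F) (hσ : ∀ x, σ (σ x) = x ^ 2)
    (p q : ((F × F) × F) ⊕ (F × F)) (h : (fiberGraph (quadRel σ) (quadRel_symm σ)).Adj p q) :
    QuadInc (quadPoint σ p) (quadLine σ q) := by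
  rcases p with ⟨⟨x, y⟩, z⟩ | ⟨x, y⟩ <;> rcases q with ⟨⟨x', y'⟩, z'⟩ | ⟨x', y'⟩ <;>
    simp only [fiberGraph, quadRel, quadPoint, quadLine, QuadInc, Prod.mk.injEq] at h ⊢
  · obtain ⟨⟨h1, h2⟩, -⟩ := h
    have h3 := congrArg σ h2
    rw [map_add, map_mul, hσ] at h3
    exact ⟨by grind, by grind⟩
  · exact ⟨h.1, by rw [h.2]⟩
  · exact ⟨by rw [h.1], h.2⟩

theorem quad_noShortEvenWalk [CharP F 2] (σ : F →+* F) (hσ : ∀ x, σ (σ x) = x ^ 2) :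
    NoShortEvenWalk (fiberGraph (quadRel σ) (quadRel_symm σ)) 3 := by
  set G := fiberGraph (quadRel σ) (quadRel_symm σ) with hG
  have hzero : ∀ p q u, G.Adj p u → G.Adj q u → quadForm (quadPoint σ p) (quadPoint σ q) = 0 :=
    fun p q u h h' => quadForm_eq_zero _ _ _ (quadInc_of_adj σ hσ p u h)
      (quadInc_of_adj σ hσ q u h')
  have hne : ∀ p u q u' r, G.Adj p u → G.Adj u q → G.Adj q u' → G.Adj u' r → p ≠ q → u ≠ u' →
      q ≠ r → quadForm (quadPoint σ p) (quadPoint σ r) ≠ 0 :=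
    fun p u q u' r h1 h2 h3 h4 hpq huu hqr =>
      quadForm_ne_zero _ _ _ _ _ (quadInc_of_adj σ hσ p u h1) (quadInc_of_adj σ hσ q u h2.symm)
        (quadInc_of_adj σ hσ q u' h3) (quadInc_of_adj σ hσ r u' h4.symm)
        ((quadPoint_injective σ).ne hpq) ((quadLine_injective σ).ne huu)
        ((quadPoint_injective σ).ne hqr)
  refine noShortEvenWalk_of_cyclic fun m hm hm3 w hw h0 h1 => ?_
  have h2 := hne (w 0) (w 1) (w 2) (w 3) (w 4) (hw.adj 0 (by omega)) (hw.adj 1 (by omega))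
    (hw.adj 2 (by omega)) (hw.adj 3 (by omega)) (hw.ne 0 (by omega)) (hw.ne 1 (by omega))
    (hw.ne 2 (by omega))
  interval_cases m
  · refine h2 ?_
    rw [h0] at *
    exact hzero _ _ (w 3) (hw.adj 3 (by omega)).symm (hw.adj 3 (by omega)).symm
  · refine h2 (hzero _ _ (w 5) ?_ (hw.adj 4 (by omega)))
    rw [h0]
    exact (hw.adj 5 (by omega)).symm

end

theorem infinite_three :
    {n : ℕ | ∃ G : SimpleGraph (Fin n), (∀ v, ¬ G.IsIsolated v) ∧
        IsNeighborly 3 (edgePolytope G) ∧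
        1 / 2 * (n : ℝ) ^ (1 + 1 / ((3 : ℕ) : ℝ)) +
            (((3 : ℕ) : ℝ) - 1) / (2 * ((3 : ℕ) : ℝ)) * (n : ℝ)
            - (n : ℝ) ^ (1 - 1 / ((3 : ℕ) : ℝ)) ≤
          ((polytopeVertices (edgePolytope G)).ncard : ℝ)}.Infinite := by
  refine infinite_of_family (by norm_num) fun N => ?_
  obtain ⟨q, hqN, F, _, _, _, σ, hq, hσ⟩ := exists_field_sqrt_frobenius 2 N
  refine ⟨q, hqN, ((F × F) × F) ⊕ (F × F), inferInstance,
    fiberGraph (quadRel σ) (quadRel_symm σ), ?_, quad_noShortEvenWalk σ hσ,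
    fiberGraph_not_isIsolated, ?_⟩
  · simp only [Fintype.card_sum, Fintype.card_prod, hq]; ring
  · have := le_two_mul_ncard_edgeSet_fiberGraph (R := quadRel σ) (hR := quadRel_symm σ) Prod.fst
      (fun v x => ((x, v.1.1 * σ x - v.2), x * σ v.1.1 - v.1.2))
      (fun v x => by simp [quadRel]) (fun v x => rfl) ?_
    · simp only [Fintype.card_prod, hq] at this
      simp only [Nat.reduceAdd, Nat.reduceSub]
      nlinarith
    · rintro ⟨⟨x, y⟩, z⟩ ⟨⟨x', y'⟩, z'⟩ ⟨h, -⟩ ⟨h', -⟩ hxy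
      simp only [Prod.mk.injEq] at h h' hxy ⊢
      obtain ⟨rfl, rfl⟩ := hxy
      exact ⟨⟨rfl, rfl⟩, add_left_cancel (h.trans h'.symm)⟩

/-! ### The generalized hexagon: `k = 5` -/

section
variable {F : Type*} [Field F]

/-- The product of the split octonions, in the coordinates of Zorn's vector matrices: an octonion
`(α, a₁, a₂, a₃, b₁, b₂, b₃, β)` consists of two scalars and two vectors. -/
def zornMul (x y : Fin 8 → F) : Fin 8 → F :=
  ![x 0 * y 0 + (x 1 * y 4 + x 2 * y 5 + x 3 * y 6),
    x 0 * y 1 + y 7 * x 1 - (x 5 * y 6 - x 6 * y 5),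
    x 0 * y 2 + y 7 * x 2 - (x 6 * y 4 - x 4 * y 6),
    x 0 * y 3 + y 7 * x 3 - (x 4 * y 5 - x 5 * y 4),
    y 0 * x 4 + x 7 * y 4 + (x 2 * y 3 - x 3 * y 2),
    y 0 * x 5 + x 7 * y 5 + (x 3 * y 1 - x 1 * y 3),
    y 0 * x 6 + x 7 * y 6 + (x 1 * y 2 - x 2 * y 1),
    x 7 * y 7 + (x 4 * y 1 + x 5 * y 2 + x 6 * y 3)]

theorem zornMul_smul_left (c : F) (x y : Fin 8 → F) : zornMul (c • x) y = c • zornMul x y := by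
  ext i
  fin_cases i <;> simp [zornMul] <;> ring

/-- The linearized right alternative law. -/
theorem zornMul_right_alternative (x y z : Fin 8 → F) :
    zornMul (zornMul x y) z + zornMul (zornMul x z) y = zornMul x (zornMul y z + zornMul z y) := by
  ext i
  fin_cases i <;> simp [zornMul] <;> ring

theorem zornMul_zero (x : Fin 8 → F) : zornMul x 0 = 0 := by
  ext i
  fin_cases i <;> simp [zornMul]

/-- Multiplication of octonions given by their eight coordinates. -/
theorem zornMul_eq_smul {x₀ x₁ x₂ x₃ x₄ x₅ x₆ x₇ y₀ y₁ y₂ y₃ y₄ y₅ y₆ y₇ z₀ z₁ z₂ z₃ z₄ z₅ z₆ z₇ : F}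
    (c : F) (h₀ : x₀ * y₀ + (x₁ * y₄ + x₂ * y₅ + x₃ * y₆) = c * z₀)
    (h₁ : x₀ * y₁ + y₇ * x₁ - (x₅ * y₆ - x₆ * y₅) = c * z₁)
    (h₂ : x₀ * y₂ + y₇ * x₂ - (x₆ * y₄ - x₄ * y₆) = c * z₂)
    (h₃ : x₀ * y₃ + y₇ * x₃ - (x₄ * y₅ - x₅ * y₄) = c * z₃)
    (h₄ : y₀ * x₄ + x₇ * y₄ + (x₂ * y₃ - x₃ * y₂) = c * z₄)
    (h₅ : y₀ * x₅ + x₇ * y₅ + (x₃ * y₁ - x₁ * y₃) = c * z₅)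
    (h₆ : y₀ * x₆ + x₇ * y₆ + (x₁ * y₂ - x₂ * y₁) = c * z₆)
    (h₇ : x₇ * y₇ + (x₄ * y₁ + x₅ * y₂ + x₆ * y₃) = c * z₇) :
    zornMul ![x₀, x₁, x₂, x₃, x₄, x₅, x₆, x₇] ![y₀, y₁, y₂, y₃, y₄, y₅, y₆, y₇] =
      c • ![z₀, z₁, z₂, z₃, z₄, z₅, z₆, z₇] := by
  ext i
  fin_cases i
  exacts [h₀, h₁, h₂, h₃, h₄, h₅, h₆, h₇]

/-- Coordinates of points, and likewise of lines, of the split Cayley hexagon: quintuples for the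
elements in general position with respect to a fixed flag, and quadruples for the elements incident
with all quintuples of the other kind that extend them. The remaining elements are left out. -/
abbrev HexElt (F : Type*) := ((F × F × F × F) × F) ⊕ (F × F × F × F)

/-- Incidence of a point and a line of the split Cayley hexagon. -/
def HexInc : HexElt F → HexElt F → Prop
  | .inl ((a, l, a', l'), a''), .inl ((k, b, k', b'), k'') =>
      b = a'' - a * k ∧ b' = a ^ 2 * k + a' - 2 * a * a'' ∧
      k'' = a ^ 3 * k + l - 3 * a'' * a ^ 2 + 3 * a * a' ∧
      k' = a ^ 3 * k ^ 2 + l' - k * l - 3 * a ^ 2 * a'' * k - 3 * a' * a'' + 3 * a * a'' ^ 2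
  | .inl (s, _), .inr t => s = t
  | .inr t, .inl (s, _) => s = t
  | .inr _, .inr _ => False

/-- The points of the hexagon as octonions of trace and norm zero. Collinear points have
product zero. -/
def hexPoint : HexElt F → Fin 8 → F
  | .inl ((a, l, a', l'), a'') =>
      ![a' - a * a'', -a * l' + a' ^ 2 + a'' * l + a * a' * a'', -a'', -a, -1,
        -(l + 2 * a * a' - a ^ 2 * a''), l' - a' * a'', -a' + a * a'']
  | .inr (k, b, k', b') => ![-b, k' + b * b', k, 1, 0, -b', -(b ^ 2 - b' * k), b]

/-- The coordinates of a point in terms of a line through it and of its first coordinate. -/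
theorem hexInc_iff (a l a' l' a'' k b k' b' k'' : F) :
    HexInc (.inl ((a, l, a', l'), a'')) (.inl ((k, b, k', b'), k'')) ↔
      a'' = a * k + b ∧ a' = b' - a ^ 2 * k + 2 * a * a'' ∧
      l = k'' - a ^ 3 * k + 3 * a'' * a ^ 2 - 3 * a * a' ∧
      l' = k' - a ^ 3 * k ^ 2 + k * l + 3 * a ^ 2 * a'' * k + 3 * a' * a'' - 3 * a * a'' ^ 2 := by
  simp only [HexInc]
  constructor
  · rintro ⟨h1, h2, h3, h4⟩
    exact ⟨by rw [h1]; ring, by rw [h2]; ring, by rw [h3]; ring, by rw [h4]; ring⟩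
  · rintro ⟨h1, h2, h3, h4⟩
    exact ⟨by rw [h1]; ring, by rw [h2]; ring, by rw [h3]; ring, by rw [h4]; ring⟩

theorem hexPoint_mul_eq_zero (p q u : HexElt F) (h : HexInc p u) (h' : HexInc q u) :
    zornMul (hexPoint p) (hexPoint q) = 0 := by
  rw [← zero_smul F (hexPoint p)]
  rcases u with ⟨⟨k, b, k', b'⟩, k''⟩ | ⟨a, l, a', l'⟩ <;>
    rcases p with ⟨⟨c, m, c', m'⟩, c''⟩ | t <;> rcases q with ⟨⟨d, n, d', n'⟩, d''⟩ | t'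
  · rw [hexInc_iff] at h h'
    obtain ⟨rfl, rfl, rfl, rfl⟩ := h
    obtain ⟨rfl, rfl, rfl, rfl⟩ := h'
    simp only [hexPoint]
    apply zornMul_eq_smul <;> ring
  · rw [hexInc_iff] at h
    obtain ⟨rfl, rfl, rfl, rfl⟩ := h
    obtain rfl : (k, b, k', b') = t' := h'
    simp only [hexPoint]
    apply zornMul_eq_smul <;> ring
  · rw [hexInc_iff] at h'
    obtain ⟨rfl, rfl, rfl, rfl⟩ := h'
    obtain rfl : (k, b, k', b') = t := h
    simp only [hexPoint]
    apply zornMul_eq_smul <;> ring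
  · obtain rfl : (k, b, k', b') = t := h
    obtain rfl : (k, b, k', b') = t' := h'
    simp only [hexPoint]
    apply zornMul_eq_smul <;> ring
  · obtain ⟨rfl, rfl, rfl, rfl⟩ : c = a ∧ m = l ∧ c' = a' ∧ m' = l' := by
      simpa [HexInc] using h
    obtain ⟨rfl, rfl, rfl, rfl⟩ : d = c ∧ n = m ∧ d' = c' ∧ n' = m' := by
      simpa [HexInc] using h'
    simp only [hexPoint]
    apply zornMul_eq_smul <;> ring
  all_goals exact False.elim (by assumption)

/-- Two points on a common line that have the same first coordinate are equal. -/
theorem hexInc_point_ne {a l a' l' a'' c m c' m' c'' : F} {s : F × F × F × F} {k'' : F}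
    (h : HexInc (.inl ((a, l, a', l'), a'')) (.inl (s, k'')))
    (h' : HexInc (.inl ((c, m, c', m'), c'')) (.inl (s, k'')))
    (hne : (Sum.inl ((a, l, a', l'), a'') : HexElt F) ≠ .inl ((c, m, c', m'), c'')) :
    a - c ≠ 0 := by
  obtain ⟨k, b, k', b'⟩ := s
  rw [hexInc_iff] at h h'
  intro hac
  obtain rfl := sub_eq_zero.1 hac
  obtain ⟨rfl, rfl, rfl, rfl⟩ := h
  obtain ⟨rfl, rfl, rfl, rfl⟩ := h'
  exact hne rfl

/-- Two lines through a common point that have the same first coordinate are equal. -/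
theorem hexInc_line_ne {k b k' b' k'' f g f' g' f'' : F} {s : F × F × F × F} {a'' : F}
    (h : HexInc (.inl (s, a'')) (.inl ((k, b, k', b'), k'')))
    (h' : HexInc (.inl (s, a'')) (.inl ((f, g, f', g'), f'')))
    (hne : (Sum.inl ((k, b, k', b'), k'') : HexElt F) ≠ .inl ((f, g, f', g'), f'')) :
    k - f ≠ 0 := by
  obtain ⟨a, l, a', l'⟩ := s
  intro hkf
  obtain rfl := sub_eq_zero.1 hkf
  obtain ⟨rfl, rfl, rfl, rfl⟩ := h
  obtain ⟨rfl, rfl, rfl, rfl⟩ := h'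
  exact hne rfl

/-- If `p, q` lie on `u` and `q, r` lie on another line `u'`, then the product of `p` and `r` is a
nonzero multiple of `q`. The factor is the product of the differences of the coordinates that
distinguish `u` from `u'`, `p` from `q` on `u`, and `q` from `r` on `u'`. -/
theorem hexPoint_mul_eq_smul (p q r u u' : HexElt F) (h1 : HexInc p u)
    (h2 : HexInc q u) (h3 : HexInc q u') (h4 : HexInc r u') (hpq : p ≠ q) (huu : u ≠ u')
    (hqr : q ≠ r) : ∃ c : F, c ≠ 0 ∧ zornMul (hexPoint p) (hexPoint r) = c • hexPoint q := by
  rcases q with ⟨⟨a, l, a', l'⟩, a''⟩ | ⟨k, b, k', b'⟩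
  · rcases u with ⟨⟨k, b, k', b'⟩, k''⟩ | s <;> rcases u' with ⟨⟨f, g, f', g'⟩, f''⟩ | s'
    · have hkf := hexInc_line_ne h2 h3 huu
      rcases p with ⟨⟨c, m, c', m'⟩, c''⟩ | t <;> rcases r with ⟨⟨d, n, d', n'⟩, d''⟩ | t'
      · have hca := hexInc_point_ne h1 h2 hpq
        have had := hexInc_point_ne h3 h4 hqr
        refine ⟨(c - a) * (a - d) * (k - f), mul_ne_zero (mul_ne_zero hca had) hkf, ?_⟩
        obtain ⟨rfl, rfl, rfl, rfl⟩ := h2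
        obtain ⟨rfl, rfl, rfl, rfl⟩ := h3
        rw [hexInc_iff] at h1 h4
        obtain ⟨rfl, rfl, rfl, rfl⟩ := h1
        obtain ⟨rfl, rfl, rfl, rfl⟩ := h4
        simp only [hexPoint]
        apply zornMul_eq_smul <;> ring
      · have hca := hexInc_point_ne h1 h2 hpq
        refine ⟨(c - a) * (k - f), mul_ne_zero hca hkf, ?_⟩
        obtain ⟨rfl, rfl, rfl, rfl⟩ := h2
        obtain ⟨rfl, rfl, rfl, rfl⟩ := h3
        rw [hexInc_iff] at h1
        obtain ⟨rfl, rfl, rfl, rfl⟩ := h1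
        obtain rfl := h4
        simp only [hexPoint]
        apply zornMul_eq_smul <;> ring
      · have had := hexInc_point_ne h3 h4 hqr
        refine ⟨-((a - d) * (k - f)), neg_ne_zero.2 (mul_ne_zero had hkf), ?_⟩
        obtain ⟨rfl, rfl, rfl, rfl⟩ := h2
        obtain ⟨rfl, rfl, rfl, rfl⟩ := h3
        rw [hexInc_iff] at h4
        obtain ⟨rfl, rfl, rfl, rfl⟩ := h4
        obtain rfl := h1
        simp only [hexPoint]
        apply zornMul_eq_smul <;> ring
      · refine ⟨-(k - f), neg_ne_zero.2 hkf, ?_⟩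
        obtain ⟨rfl, rfl, rfl, rfl⟩ := h2
        obtain ⟨rfl, rfl, rfl, rfl⟩ := h3
        obtain rfl := h1
        obtain rfl := h4
        simp only [hexPoint]
        apply zornMul_eq_smul <;> ring
    · obtain rfl := h3
      rcases r with ⟨s, d''⟩ | t'
      swap
      · exact h4.elim
      obtain rfl : s = (a, l, a', l') := h4
      have had : a'' - d'' ≠ 0 := fun h => hqr (by rw [sub_eq_zero.1 h])
      rcases p with ⟨⟨c, m, c', m'⟩, c''⟩ | t
      · have hca := hexInc_point_ne h1 h2 hpq
        refine ⟨-((c - a) * (a'' - d'')), neg_ne_zero.2 (mul_ne_zero hca had), ?_⟩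
        obtain ⟨rfl, rfl, rfl, rfl⟩ := h2
        rw [hexInc_iff] at h1
        obtain ⟨rfl, rfl, rfl, rfl⟩ := h1
        simp only [hexPoint]
        apply zornMul_eq_smul <;> ring
      · refine ⟨a'' - d'', had, ?_⟩
        obtain ⟨rfl, rfl, rfl, rfl⟩ := h2
        obtain rfl := h1
        simp only [hexPoint]
        apply zornMul_eq_smul <;> ring
    · obtain rfl := h2
      rcases p with ⟨s, c''⟩ | t
      swap
      · exact h1.elim
      obtain rfl : s = (a, l, a', l') := h1
      have hca : c'' - a'' ≠ 0 := fun h => hpq (by rw [sub_eq_zero.1 h])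
      rcases r with ⟨⟨d, n, d', n'⟩, d''⟩ | t'
      · have had := hexInc_point_ne h3 h4 hqr
        refine ⟨(c'' - a'') * (a - d), mul_ne_zero hca had, ?_⟩
        obtain ⟨rfl, rfl, rfl, rfl⟩ := h3
        rw [hexInc_iff] at h4
        obtain ⟨rfl, rfl, rfl, rfl⟩ := h4
        simp only [hexPoint]
        apply zornMul_eq_smul <;> ring
      · refine ⟨c'' - a'', hca, ?_⟩
        obtain ⟨rfl, rfl, rfl, rfl⟩ := h3
        obtain rfl := h4
        simp only [hexPoint]
        apply zornMul_eq_smul <;> ring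
    · obtain rfl := h2
      obtain rfl := h3
      exact absurd rfl huu
  · rcases u with ⟨s, k''⟩ | s
    swap
    · exact h2.elim
    rcases u' with ⟨s', f''⟩ | s'
    swap
    · exact h3.elim
    obtain rfl := h2
    obtain rfl := h3
    have hkf : k'' - f'' ≠ 0 := fun h => huu (by rw [sub_eq_zero.1 h])
    rcases p with ⟨⟨c, m, c', m'⟩, c''⟩ | t
    swap
    · exact absurd (by rw [show (k, b, k', b') = t from h1]) hpq.symm
    rcases r with ⟨⟨d, n, d', n'⟩, d''⟩ | t'
    swap
    · exact absurd (by rw [show (k, b, k', b') = t' from h4]) hqr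
    refine ⟨k'' - f'', hkf, ?_⟩
    rw [hexInc_iff] at h1 h4
    obtain ⟨rfl, rfl, rfl, rfl⟩ := h1
    obtain ⟨rfl, rfl, rfl, rfl⟩ := h4
    simp only [hexPoint]
    apply zornMul_eq_smul <;> ring

theorem hexPoint_ne_zero (p : HexElt F) : hexPoint p ≠ 0 := by
  intro h
  rcases p with ⟨⟨a, l, a', l'⟩, a''⟩ | ⟨k, b, k', b'⟩
  · simpa [hexPoint] using congrFun h 4
  · simpa [hexPoint] using congrFun h 3

theorem eq_of_hexPoint_eq_smul (p q : HexElt F) (c : F) (h : hexPoint p = c • hexPoint q) :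
    p = q := by
  rcases p with ⟨⟨a, l, a', l'⟩, a''⟩ | ⟨k, b, k', b'⟩ <;>
    rcases q with ⟨⟨d, m, d', m'⟩, d''⟩ | ⟨f, g, f', g'⟩ <;>
    have h1 := congrFun h 1 <;> have h2 := congrFun h 2 <;> have h3 := congrFun h 3 <;>
    have h4 := congrFun h 4 <;> have h5 := congrFun h 5 <;> have h6 := congrFun h 6 <;>
    have h7 := congrFun h 7 <;> clear h <;>
    simp [hexPoint] at h1 h2 h3 h4 h5 h6 h7 ⊢ <;> grind

/-- Adjacency of the affine points of the polarity graph of the split Cayley hexagon. -/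
def hexRel (σ : F →+* F) (v v' : (F × F × F × F) × F) : Prop :=
  match v, v' with
  | ((x, y, z, u), w), ((x', y', z', u'), w') =>
    w = y' + x * σ x' ∧ w' = y + x' * σ x ∧
      z' = σ x * x' ^ 2 + u - x' * y ∧ z = σ x' * x ^ 2 + u' - x * y'

theorem hexRel_symm (σ : F →+* F) (v v' : (F × F × F × F) × F) (h : hexRel σ v v') :
    hexRel σ v' v := by
  obtain ⟨⟨x, y, z, u⟩, w⟩ := v
  obtain ⟨⟨x', y', z', u'⟩, w'⟩ := v'
  exact ⟨h.2.1, h.1, h.2.2.2, h.2.2.1⟩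

/-- The vertices of the polarity graph as points of the hexagon. -/
def hexVertex (σ : F →+* F) : ((F × F × F × F) × F) ⊕ (F × F × F × F) → HexElt F
  | .inl ((x, y, z, u), w) => .inl ((x, σ y, z, σ u), w)
  | .inr (x, y, z, u) => .inr (σ x, y, σ z, u)

/-- The image under the polarity: the vertices of the polarity graph as lines. -/
def hexLine (σ : F →+* F) : ((F × F × F × F) × F) ⊕ (F × F × F × F) → HexElt F
  | .inl ((x, y, z, u), w) => .inl ((σ x, y, σ z, u), σ w)
  | .inr (x, y, z, u) => .inr (x, σ y, z, σ u)

theorem hexVertex_injective (σ : F →+* F) : Function.Injective (hexVertex σ) := by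
  rintro (⟨⟨x, y, z, u⟩, w⟩ | ⟨x, y, z, u⟩) (⟨⟨x', y', z', u'⟩, w'⟩ | ⟨x', y', z', u'⟩) h <;>
    simp_all [hexVertex, σ.injective.eq_iff]

theorem hexLine_injective (σ : F →+* F) : Function.Injective (hexLine σ) := by
  rintro (⟨⟨x, y, z, u⟩, w⟩ | ⟨x, y, z, u⟩) (⟨⟨x', y', z', u'⟩, w'⟩ | ⟨x', y', z', u'⟩) h <;>
    simp_all [hexLine, σ.injective.eq_iff]

theorem hexInc_of_adj [CharP F 3] (σ : F →+* F) (hσ : ∀ x, σ (σ x) = x ^ 3)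
    (p q : ((F × F × F × F) × F) ⊕ (F × F × F × F))
    (h : (fiberGraph (hexRel σ) (hexRel_symm σ)).Adj p q) :
    HexInc (hexVertex σ p) (hexLine σ q) := by
  rcases p with ⟨⟨x, y, z, u⟩, w⟩ | ⟨x, y, z, u⟩ <;>
    rcases q with ⟨⟨x', y', z', u'⟩, w'⟩ | ⟨x', y', z', u'⟩ <;>
    simp only [fiberGraph, hexRel, hexVertex, hexLine, HexInc, Prod.mk.injEq] at h ⊢
  · obtain ⟨⟨h1, h2, h3, h4⟩, -⟩ := h
    have h5 := congrArg σ h2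
    have h6 := congrArg σ h3
    simp only [map_add, map_sub, map_mul, map_pow, hσ] at h5 h6
    refine ⟨by grind, by grind, by grind, by grind⟩
  · obtain ⟨rfl, rfl, rfl, rfl⟩ := h
    simp
  · obtain ⟨rfl, rfl, rfl, rfl⟩ := h
    simp

/-- A closed walk alternates between points and lines of the hexagon, so it is an ordinary `m`-gon
with `m ≤ 5`. In a pentagon `p₀, p₁, p₂, p₃, p₄` of points the alternative law
`(p₀ p₂) p₃ + (p₀ p₃) p₂ = p₀ (p₂ p₃ + p₃ p₂) = 0` makes `p₁ p₃`, a multiple of `p₂`,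
proportional to `p₄ p₂`, a multiple of `p₃`. -/
theorem hex_noShortEvenWalk [CharP F 3] (σ : F →+* F) (hσ : ∀ x, σ (σ x) = x ^ 3) :
    NoShortEvenWalk (fiberGraph (hexRel σ) (hexRel_symm σ)) 5 := by
  set G := fiberGraph (hexRel σ) (hexRel_symm σ) with hG
  set φ := fun p => hexPoint (hexVertex σ p) with hφ
  have hzero : ∀ p q u, G.Adj p u → G.Adj q u → zornMul (φ p) (φ q) = 0 :=
    fun p q u h h' => hexPoint_mul_eq_zero _ _ _ (hexInc_of_adj σ hσ p u h)
      (hexInc_of_adj σ hσ q u h')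
  have hne : ∀ p u q u' r, G.Adj p u → G.Adj u q → G.Adj q u' → G.Adj u' r → p ≠ q → u ≠ u' →
      q ≠ r → ∃ c : F, c ≠ 0 ∧ zornMul (φ p) (φ r) = c • φ q :=
    fun p u q u' r h1 h2 h3 h4 hpq huu hqr =>
      hexPoint_mul_eq_smul _ _ _ _ _ (hexInc_of_adj σ hσ p u h1)
        (hexInc_of_adj σ hσ q u h2.symm)
        (hexInc_of_adj σ hσ q u' h3) (hexInc_of_adj σ hσ r u' h4.symm)
        ((hexVertex_injective σ).ne hpq) ((hexLine_injective σ).ne huu)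
        ((hexVertex_injective σ).ne hqr)
  have hsmul : ∀ p (c : F), c ≠ 0 → c • φ p ≠ 0 := fun p c hc =>
    smul_ne_zero hc (hexPoint_ne_zero _)
  have hinj : ∀ p q (c d : F), c ≠ 0 → c • φ p = d • φ q → p = q := by
    intro p q c d hc h
    refine hexVertex_injective σ (eq_of_hexPoint_eq_smul _ _ (c⁻¹ * d) ?_)
    have := congrArg (fun x => c⁻¹ • x) h
    simpa only [smul_smul, inv_mul_cancel₀ hc, one_smul] using this
  refine noShortEvenWalk_of_cyclic fun m hm hm5 w hw h0 h1 => ?_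
  obtain ⟨c, hc, h2⟩ := hne (w 0) (w 1) (w 2) (w 3) (w 4) (hw.adj 0 (by omega))
    (hw.adj 1 (by omega)) (hw.adj 2 (by omega)) (hw.adj 3 (by omega)) (hw.ne 0 (by omega))
    (hw.ne 1 (by omega)) (hw.ne 2 (by omega))
  interval_cases m
  · refine hsmul (w 2) c hc ?_
    have h4 : w 4 = w 0 := h0.symm
    rw [← h2, h4]
    exact hzero _ _ (w 1) (hw.adj 0 (by omega)) (hw.adj 0 (by omega))
  · refine hsmul (w 2) c hc ?_
    rw [← h2]
    refine hzero _ _ (w 5) ?_ (hw.adj 4 (by omega))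
    rw [h0]
    exact (hw.adj 5 (by omega)).symm
  · -- the two paths from `w 0` to `w 4` have the same middle point, hence there is a shorter cycle
    have a7 : G.Adj (w 7) (w 0) := by rw [h0]; exact hw.adj 7 (by omega)
    have n6 : w 6 ≠ w 0 := by rw [h0]; exact hw.ne 6 (by omega)
    obtain ⟨d, hd, h3⟩ := hne (w 0) (w 7) (w 6) (w 5) (w 4) a7.symm (hw.adj 6 (by omega)).symm
      (hw.adj 5 (by omega)).symm (hw.adj 4 (by omega)).symm n6.symm (hw.ne 5 (by omega)).symm
      (hw.ne 4 (by omega)).symm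
    have h4 : w 2 = w 6 := hinj _ _ c d hc (h2.symm.trans h3)
    obtain ⟨e, he, h5⟩ := hne (w 6) (w 7) (w 0) (w 1) (w 2) (hw.adj 6 (by omega)) a7
      (hw.adj 0 (by omega)) (hw.adj 1 (by omega)) n6 h1.symm (hw.ne 0 (by omega))
    refine hsmul (w 0) e he ?_
    rw [← h5, h4]
    exact hzero _ _ (w 7) (hw.adj 6 (by omega)) (hw.adj 6 (by omega))
  · have a9 : G.Adj (w 9) (w 0) := by rw [h0]; exact hw.adj 9 (by omega)
    have n8 : w 8 ≠ w 0 := by rw [h0]; exact hw.ne 8 (by omega)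
    obtain ⟨d, hd, h3⟩ := hne (w 0) (w 9) (w 8) (w 7) (w 6) a9.symm (hw.adj 8 (by omega)).symm
      (hw.adj 7 (by omega)).symm (hw.adj 6 (by omega)).symm n8.symm (hw.ne 7 (by omega)).symm
      (hw.ne 6 (by omega)).symm
    obtain ⟨e, he, h4⟩ := hne (w 2) (w 3) (w 4) (w 5) (w 6) (hw.adj 2 (by omega))
      (hw.adj 3 (by omega)) (hw.adj 4 (by omega)) (hw.adj 5 (by omega)) (hw.ne 2 (by omega))
      (hw.ne 3 (by omega)) (hw.ne 4 (by omega))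
    obtain ⟨f, hf, h5⟩ := hne (w 8) (w 7) (w 6) (w 5) (w 4) (hw.adj 7 (by omega)).symm
      (hw.adj 6 (by omega)).symm (hw.adj 5 (by omega)).symm (hw.adj 4 (by omega)).symm
      (hw.ne 6 (by omega)).symm (hw.ne 5 (by omega)).symm (hw.ne 4 (by omega)).symm
    have h6 := zornMul_right_alternative (φ (w 0)) (φ (w 4)) (φ (w 6))
    rw [hzero (w 4) (w 6) (w 5) (hw.adj 4 (by omega)) (hw.adj 5 (by omega)).symm,
      hzero (w 6) (w 4) (w 5) (hw.adj 5 (by omega)).symm (hw.adj 4 (by omega)), add_zero,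
      zornMul_zero, h2, h3, zornMul_smul_left, zornMul_smul_left, h4, h5, smul_smul, smul_smul,
      add_eq_zero_iff_eq_neg, ← neg_smul] at h6
    exact hw.ne 4 (by omega) (hinj _ _ _ _ (mul_ne_zero hc he) h6)

end

theorem infinite_five :
    {n : ℕ | ∃ G : SimpleGraph (Fin n), (∀ v, ¬ G.IsIsolated v) ∧
        IsNeighborly 5 (edgePolytope G) ∧
        1 / 2 * (n : ℝ) ^ (1 + 1 / ((5 : ℕ) : ℝ)) +
            (((5 : ℕ) : ℝ) - 1) / (2 * ((5 : ℕ) : ℝ)) * (n : ℝ)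
            - (n : ℝ) ^ (1 - 1 / ((5 : ℕ) : ℝ)) ≤
          ((polytopeVertices (edgePolytope G)).ncard : ℝ)}.Infinite := by
  refine infinite_of_family (by norm_num) fun N => ?_
  obtain ⟨q, hqN, F, _, _, _, σ, hq, hσ⟩ := exists_field_sqrt_frobenius 3 N
  refine ⟨q, hqN, ((F × F × F × F) × F) ⊕ (F × F × F × F), inferInstance,
    fiberGraph (hexRel σ) (hexRel_symm σ), ?_, hex_noShortEvenWalk σ hσ,
    fiberGraph_not_isIsolated, ?_⟩
  · simp only [Fintype.card_sum, Fintype.card_prod, hq]; ring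
  · have := le_two_mul_ncard_edgeSet_fiberGraph (R := hexRel σ) (hR := hexRel_symm σ) Prod.fst
      (fun v x => ((x, v.2 - v.1.1 * σ x, σ v.1.1 * x ^ 2 + v.1.2.2.2 - x * v.1.2.1,
        v.1.2.2.1 - σ x * v.1.1 ^ 2 + v.1.1 * (v.2 - v.1.1 * σ x)), v.1.2.1 + x * σ v.1.1))
      (fun v x => ⟨by ring, by ring, by ring, by ring⟩) (fun v x => rfl) ?_
    · simp only [Fintype.card_prod, hq] at this
      simp only [Nat.reduceAdd, Nat.reduceSub]
      nlinarith
    · rintro ⟨⟨x, y, z, u⟩, w⟩ ⟨⟨x', y', z', u'⟩, w'⟩ ⟨h, -⟩ ⟨h', -⟩ hxy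
      simp only [Prod.mk.injEq] at hxy ⊢
      obtain ⟨rfl, rfl, rfl, rfl⟩ := hxy
      exact ⟨⟨rfl, rfl, rfl, rfl⟩, h.trans h'.symm⟩

theorem mainTheorem3 :
    (∀ k : ℕ, 2 ≤ k →
      ∃ ε : ℕ → ℝ, Tendsto ε atTop (𝓝 0) ∧
        ∀ (n : ℕ) (G : SimpleGraph (Fin n)), IsNeighborly k (edgePolytope G) →
          ((polytopeVertices (edgePolytope G)).ncard : ℝ) ≤
            1 / 2 * (n : ℝ) ^ (1 + 1 / (k : ℝ)) +
              (((k : ℝ) - 1) / (2 * (k : ℝ)) + ε n) * (n : ℝ)) ∧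
    (∀ k : ℕ, k = 2 ∨ k = 3 ∨ k = 5 →
      {n : ℕ | ∃ G : SimpleGraph (Fin n), (∀ v, ¬ G.IsIsolated v) ∧
        IsNeighborly k (edgePolytope G) ∧
        1 / 2 * (n : ℝ) ^ (1 + 1 / (k : ℝ)) + ((k : ℝ) - 1) / (2 * (k : ℝ)) * (n : ℝ)
            - (n : ℝ) ^ (1 - 1 / (k : ℝ)) ≤
          ((polytopeVertices (edgePolytope G)).ncard : ℝ)}.Infinite) := by
  refine ⟨exists_upper_bound, ?_⟩
  rintro k (rfl | rfl | rfl)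
  exacts [infinite_two, infinite_three, infinite_five]
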